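/- **Corollary (Forbidden loops are decidable).** Consider terms over a finite signature and a countably infinite set of variables. Positions are finite words of argument indices, ordered by the prefix order $\le$ with strict part $<$; $p^n$ is the $n$-fold concatenation of $p$, and $t|_p$ is the subterm of $t$ at position $p$. A term rewrite system (TRS) $\mathcal R$ is a finite set of rules $\ell\to r$ such that $\ell$ is not a variable and every variable of $r$ occurs in $\ell$. A context $C$ is a term with exactly one occurrence of the hole $\Box$, and $C[t]$ is $C$ with $\Box$ replaced by $t$. We write $t\to_p s$ if $t=C[\ell\sigma]$ and $s=C[r\sigma]$ for a rule $\ell\to r$ of $\mathcal R$, a substitution $\sigma$, and a context $C$ with $C|_p=\Box$. For a context $C$ and a substitution $\mu$ with finite domain let $t(C,\mu)^0=t$, $t(C,\mu)^{n+1}=C[t(C,\mu)^n\mu]$, and $t(C,\mu)=t(C,\mu)^1$. A *loop* is a reduction $t_1\to_{q_1}t_2\to_{q_2}\cdots\to_{q_m}t_{m+1}=t_1(C,\mu)$ with $m\ge 1$, given together with $C$, $\mu$ and the position $p$ with $C|_p=\Box$. A *forbidden pattern* is a triple $(\ell,o,\lambda)$ of a term $\ell$, a position $o$ of $\ell$,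 and $\lambda\in\{h,a,b\}$. For a set $\Pi$ of forbidden patterns, a step $t\to_p s$ is *allowed by* $\Pi$ if there are no $(\ell,o,\lambda)\in\Pi$, position $o'$ of $t$, and substitution $\sigma$ such that $t|_{o'}=\ell\sigma$ and: $p=o'o$ if $\lambda=h$; $p<o'o$ if $\lambda=a$; $p>o'o$ if $\lambda=b$. The loop is a *$\Pi$-loop* if for all $1\le i\le m$ and all $n\in\mathbb N$ the step $t_i(C,\mu)^n\to_{p^nq_i}t_{i+1}(C,\mu)^n$ is allowed by $\Pi$. Then it is decidable whether a given loop is a $\Pi$-loop for a given finite set $\Pi$ of forbidden patterns. More precisely, there is one algorithm that, given as input a TRS over a finite signature, a loop of this TRS (with its $C$, $\mu$, $p$), and a finite set $\Pi$ of forbidden patterns (all coded as finite data), decides whether the loop is a $\Pi$-loop. -/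

import Mathlib

/-! Term rewriting over a signature, which is the family of function symbols of a first-order
language `L`. Terms are Mathlib's first-order terms and the variables are the natural numbers. -/

namespace TermRewriting

open FirstOrder.Language

universe u v w

/-- A position is a finite word of argument indices. Arguments are counted from `0`. -/
abbrev Position : Type := List ℕ

/-- `o.StrictlyAbove p` is the strict prefix order `o < p` on positions. -/
def Position.StrictlyAbove (o p : Position) : Prop := o <+: p ∧ o ≠ p

/-- `p ^ n`, the `n`-fold concatenation of the position `p`. -/
def Position.pow (p : Position) (n : ℕ) : Position := (List.replicate n p).flatten

/-- The subterm `t|_p`, or `none` if `p` is not a position of `t`. -/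
def subtermAt {L : FirstOrder.Language.{u, v}} {α : Type w} :
    L.Term α → Position → Option (L.Term α)
  | t, [] => some t
  | .var _, _ :: _ => none
  | @Term.func _ _ l _ ts, i :: p => if h : i < l then subtermAt (ts ⟨i, h⟩) p else none

/-- A context: a term with exactly one occurrence of the hole, which is the extra variable
`none`. -/
structure Context (L : FirstOrder.Language.{u, v}) where
  toTerm : L.Term (Option ℕ)
  existsUnique_hole : ∃! p : Position, subtermAt toTerm p = some (Term.var none)

/-- `C|_p = □`. -/
def Context.HoleAt {L : FirstOrder.Language.{u, v}} (C : Context L) (p : Position) : Prop :=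
  subtermAt C.toTerm p = some (Term.var none)

/-- `C[t]`. -/
def Context.fill {L : FirstOrder.Language.{u, v}} (C : Context L) (t : L.Term ℕ) : L.Term ℕ :=
  C.toTerm.subst fun x => x.elim t Term.var

/-- A substitution with finite domain, given by a list of bindings `x / t`. -/
abbrev FinSubst (L : FirstOrder.Language.{u, v}) : Type u := List (ℕ × L.Term ℕ)

/-- The map from variables to terms given by a list of bindings: the first binding of a variable
counts, and a variable without a binding is mapped to itself. -/
def FinSubst.toFun {L : FirstOrder.Language.{u, v}} (μ : FinSubst L) (x : ℕ) : L.Term ℕ :=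
  (List.lookup x μ).getD (Term.var x)

/-- The term `t(C,μ)^n`. -/
def ctxSubst {L : FirstOrder.Language.{u, v}} (C : Context L) (μ : FinSubst L) (t : L.Term ℕ) :
    ℕ → L.Term ℕ
  | 0 => t
  | n + 1 => C.fill ((ctxSubst C μ t n).subst μ.toFun)

/-- A rewrite rule `ℓ → r`: `ℓ` is not a variable and every variable of `r` occurs in `ℓ`. -/
structure Rule (L : FirstOrder.Language.{u, v}) where
  lhs : L.Term ℕ
  rhs : L.Term ℕ
  lhs_ne_var : ∀ x : ℕ, lhs ≠ Term.var x
  vars_subset : ∀ x ∈ rhs.varFinset, x ∈ lhs.varFinset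

/-- A (finite) term rewrite system. -/
abbrev TRS (L : FirstOrder.Language.{u, v}) : Type u := List (Rule L)

/-- `Step R p t s` is the rewrite step `t →_p s` at position `p`. -/
def Step {L : FirstOrder.Language.{u, v}} (R : TRS L) (p : Position) (t s : L.Term ℕ) : Prop :=
  ∃ ρ ∈ R, ∃ (σ : ℕ → L.Term ℕ) (C : Context L), C.HoleAt p ∧
    t = C.fill (ρ.lhs.subst σ) ∧ s = C.fill (ρ.rhs.subst σ)

/-- The three types of forbidden patterns (here, above, below). -/
inductive PatternKind : Type
  | h
  | a
  | b

/-- A forbidden pattern `(ℓ, o, kind)` with `o` a position of `ℓ`. -/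
structure ForbiddenPattern (L : FirstOrder.Language.{u, v}) where
  term : L.Term ℕ
  pos : Position
  kind : PatternKind
  pos_mem : ∃ u : L.Term ℕ, subtermAt term pos = some u

/-- How a redex position `p` has to lie with respect to `o'o` in order to be forbidden. -/
def PatternKind.Forbids : PatternKind → Position → Position → Prop
  | .h, p, oo => p = oo
  | .a, p, oo => p.StrictlyAbove oo
  | .b, p, oo => oo.StrictlyAbove p

/-- The rewrite relation under a set of forbidden patterns. -/
def PatternStep {L : FirstOrder.Language.{u, v}} (R : TRS L) (Pat : Set (ForbiddenPattern L))
    (p : Position) (t s : L.Term ℕ) : Prop :=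
  Step R p t s ∧
    ¬ ∃ π ∈ Pat, ∃ (o' : Position) (σ : ℕ → L.Term ℕ),
      subtermAt t o' = some (π.term.subst σ) ∧ π.kind.Forbids p (o' ++ π.pos)

/-- A loop `t_1 →_{q_1} ⋯ →_{q_m} t_{m+1} = t_1(C,μ)` with `m ≥ 1` and `C|_p = □`. -/
structure Loop {L : FirstOrder.Language.{u, v}} (R : TRS L) where
  m : ℕ
  m_pos : 0 < m
  t : Fin (m + 1) → L.Term ℕ
  q : Fin m → Position
  C : Context L
  μ : FinSubst L
  p : Position
  hole : C.HoleAt p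
  step : ∀ i : Fin m, Step R (q i) (t i.castSucc) (t i.succ)
  closes : t (Fin.last m) = ctxSubst C μ (t 0) 1

/-- A loop is an `S`-loop for a strategy `S` (a restriction `S p t s` of `t →_p s`) if all the
reductions `t_i(C,μ)^n →_{p^n q_i} t_{i+1}(C,μ)^n` respect `S`. -/
def Loop.IsStrategyLoop {L : FirstOrder.Language.{u, v}} {R : TRS L} (ℓ : Loop R)
    (S : Position → L.Term ℕ → L.Term ℕ → Prop) : Prop :=
  ∀ (i : Fin ℓ.m) (n : ℕ),
    S (ℓ.p.pow n ++ ℓ.q i)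
      (ctxSubst ℓ.C ℓ.μ (ℓ.t i.castSucc) n) (ctxSubst ℓ.C ℓ.μ (ℓ.t i.succ) n)

/-! ### Encoding of the inputs as finite data

Function symbols are numbered by `e`. A term is written as the list of its symbols in prefix
order, where every function symbol is written as its arity and its number. -/

/-- The code of a term with variables in `α`. -/
abbrev TermCode (α : Type) : Type := List (α ⊕ ℕ × ℕ)

def termCode {L : FirstOrder.Language.{u, v}} {α : Type} (e : (Σ n, L.Functions n) ↪ ℕ)
    (t : L.Term α) : TermCode α :=
  t.listEncode.map (Sum.map id fun f => (f.1, e f))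

def PatternKind.code : PatternKind → ℕ
  | .h => 0
  | .a => 1
  | .b => 2

/-- The code of a term rewrite system: its list of pairs of left- and right-hand sides. -/
def trsCode {L : FirstOrder.Language.{u, v}} (e : (Σ n, L.Functions n) ↪ ℕ) (R : TRS L) :
    List (TermCode ℕ × TermCode ℕ) :=
  R.map fun ρ => (termCode e ρ.lhs, termCode e ρ.rhs)

/-- The code of a loop: the terms `t_1, …, t_{m+1}`, the positions `q_1, …, q_m`, the context `C`,
the substitution `μ`, and the position `p`. -/
def loopCode {L : FirstOrder.Language.{u, v}} (e : (Σ n, L.Functions n) ↪ ℕ) {R : TRS L} (ℓ : Loop R) :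
    List (TermCode ℕ) × List Position × TermCode (Option ℕ) × List (ℕ × TermCode ℕ) × Position :=
  (List.ofFn fun i => termCode e (ℓ.t i), List.ofFn ℓ.q, termCode e ℓ.C.toTerm,
    ℓ.μ.map fun b => (b.1, termCode e b.2), ℓ.p)

/-- The code of a finite set of forbidden patterns, given as a list. -/
def patternsCode {L : FirstOrder.Language.{u, v}} (e : (Σ n, L.Functions n) ↪ ℕ)
    (Pat : List (ForbiddenPattern L)) : List (TermCode ℕ × Position × ℕ) :=
  Pat.map fun π => (termCode e π.term, π.pos, π.kind.code)

/-- The type of codes of inputs: a term rewrite system, a loop, and a list of patterns. -/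
abbrev InputCode : Type :=
  List (TermCode ℕ × TermCode ℕ) ×
  (List (TermCode ℕ) × List Position × TermCode (Option ℕ) × List (ℕ × TermCode ℕ) × Position) ×
  List (TermCode ℕ × Position × ℕ)

def inputCode {L : FirstOrder.Language.{u, v}} (e : (Σ n, L.Functions n) ↪ ℕ) (R : TRS L) (ℓ : Loop R)
    (Pat : List (ForbiddenPattern L)) : InputCode :=
  (trsCode e R, loopCode e ℓ, patternsCode e Pat)

end TermRewriting

namespace TermRewriting

open FirstOrder.Language

universe u v

/-! ### Subterms, matching and iterated substitutions -/

section Terms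

variable {L : FirstOrder.Language.{u, v}} {α β γ : Type*}

/-! The steps of a loop lift to every exponent (`Step.ctxSubst`), so a loop fails to be a `Π`-loop
only through a violation: a pattern that matches in some `t_i(C,μ)^n` at a position lying, relative
to `p^n q_i`, as its kind demands. The proof computes a bound on the exponents that have to be
searched.

It is convenient to look for violations in `t(C,μ)^m μ^k`. The subterm of `t(C,μ)^(m+1) μ^k` at `p`
is `t(C,μ)^m μ^(k+1)`, so contexts above a match can be traded for substitutions and back
(`Violates.exists_not_prefix`, `Violates.add`). Hence either `m = 0`, or the match is not at or
below `p`; being comparable with the redex position, it is then at a proper prefix of `p`. It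
remains to bound `k` and `m`.

For `k`, let `D` contain the domain of `μ`. The instances by `μ^k` form a free term algebra over the
instances not composed of others. Apart from variables outside `D`, the number of these generators
never grows with `k`, so it stalls within `D.card` steps. At that moment `μ` is injective on the
instances, and no further terms get identified (`substIter_card_eq`). A similar argument for
function symbols shows that `(d + 2) * D.card` iterations decide matching against a pattern of depth
at most `d` (`matches_substIter_of_le`). Matches inside some `x μ^k` are handled by reachability of
variables (`IsSubtermOfIter.exists_matches`).

For `m`, a pattern sees only the top of a high tower of contexts, and subterms on the path to the
hole are too deep to equal nearby ones off the path. So a match survives the removal of one context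
(`matches_ctxSubst_pred`), down to a computable height.

Finally, the bounded search is expressed by primitive recursive functions on codes, which do not
refer to the signature. -/

theorem term_subst_var (t : L.Term α) : t.subst Term.var = t := by
  induction t with
  | var => rfl
  | func f ts ih => simp only [Term.subst, ih]

theorem term_subst_subst (t : L.Term α) (σ : α → L.Term β) (τ : β → L.Term γ) :
    (t.subst σ).subst τ = t.subst fun x => (σ x).subst τ := by
  induction t with
  | var => rfl
  | func f ts ih => simp only [Term.subst, ih]

@[simp] theorem subtermAt_nil (t : L.Term α) : subtermAt t [] = some t := by
  cases t <;> rfl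

@[simp] theorem subtermAt_var_cons (x : α) (i : ℕ) (p : Position) :
    subtermAt (Term.var x : L.Term α) (i :: p) = none := rfl

theorem subtermAt_func_cons {n : ℕ} (f : L.Functions n) (ts : Fin n → L.Term α) (i : ℕ)
    (p : Position) : subtermAt (Term.func f ts) (i :: p) =
      if h : i < n then subtermAt (ts ⟨i, h⟩) p else none := rfl

theorem subtermAt_func_cons_of_lt {n : ℕ} (f : L.Functions n) (ts : Fin n → L.Term α) {i : ℕ}
    (h : i < n) (p : Position) : subtermAt (Term.func f ts) (i :: p) = subtermAt (ts ⟨i, h⟩) p := by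
  rw [subtermAt_func_cons, dif_pos h]

theorem exists_func_of_subtermAt_cons {t u : L.Term α} {i : ℕ} {p : Position}
    (h : subtermAt t (i :: p) = some u) : ∃ (n : ℕ) (f : L.Functions n) (ts : Fin n → L.Term α)
      (hi : i < n), t = Term.func f ts ∧ subtermAt (ts ⟨i, hi⟩) p = some u := by
  cases t with
  | var => simp at h
  | @func n f ts =>
    rw [subtermAt_func_cons] at h
    split_ifs at h with hi
    exact ⟨n, f, ts, hi, rfl, h⟩

theorem subtermAt_append (t : L.Term α) (p q : Position) :
    subtermAt t (p ++ q) = (subtermAt t p).bind fun u => subtermAt u q := by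
  induction p generalizing t with
  | nil => simp
  | cons i p ih =>
    cases t with
    | var => rfl
    | func f ts =>
      simp only [List.cons_append, subtermAt_func_cons]
      split_ifs
      · exact ih _
      · rfl

theorem subtermAt_append_of_eq_some {t u : L.Term α} {p : Position} (h : subtermAt t p = some u)
    (q : Position) : subtermAt t (p ++ q) = subtermAt u q := by
  rw [subtermAt_append, h, Option.bind_some]

theorem exists_subtermAt_of_append {t u : L.Term α} {p q : Position}
    (h : subtermAt t (p ++ q) = some u) :
    ∃ s, subtermAt t p = some s ∧ subtermAt s q = some u := by
  rw [subtermAt_append] at h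
  exact Option.bind_eq_some_iff.1 h

theorem subtermAt_subst {t u : L.Term α} {p : Position} (h : subtermAt t p = some u)
    (σ : α → L.Term β) : subtermAt (t.subst σ) p = some (u.subst σ) := by
  induction p generalizing t with
  | nil => simp at h; simp [h]
  | cons i p ih =>
    obtain ⟨n, f, ts, hi, rfl, h'⟩ := exists_func_of_subtermAt_cons h
    simp only [Term.subst]
    rw [subtermAt_func_cons_of_lt _ _ hi]
    exact ih h'

/-- A position of `t.subst σ` is a position of `t`, or it leads through a variable of `t`. -/
theorem subtermAt_subst_cases {t : L.Term α} {σ : α → L.Term β} {p : Position} {u : L.Term β}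
    (h : subtermAt (t.subst σ) p = some u) :
    (∃ s, subtermAt t p = some s ∧ u = s.subst σ) ∨
      ∃ p₁ p₂ x, p = p₁ ++ p₂ ∧ subtermAt t p₁ = some (Term.var x) ∧
        subtermAt (σ x) p₂ = some u := by
  induction p generalizing t with
  | nil => exact .inl ⟨t, by simpa [eq_comm] using h⟩
  | cons i p ih =>
    cases t with
    | var x => exact .inr ⟨[], i :: p, x, rfl, by simp, h⟩
    | @func n f ts =>
      obtain ⟨n', f', ts', hi, he, h⟩ := exists_func_of_subtermAt_cons h
      simp only [Term.subst, Term.func.injEq] at he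
      obtain ⟨rfl, rfl, he⟩ := he
      obtain rfl := eq_of_heq he
      obtain ⟨s, hs, rfl⟩ | ⟨p₁, p₂, x, rfl, h₁, h₂⟩ := ih h
      · exact .inl ⟨s, by rwa [subtermAt_func_cons_of_lt _ _ hi], rfl⟩
      · exact .inr ⟨i :: p₁, p₂, x, rfl, by rwa [subtermAt_func_cons_of_lt _ _ hi], h₂⟩

/-- The root symbol of a term. -/
def root : L.Term α → α ⊕ (Σ n, L.Functions n)
  | .var x => .inl x
  | .func f _ => .inr ⟨_, f⟩

/-- The symbol of `t` at the position `p`. -/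
def rootAt (t : L.Term α) (p : Position) : Option (α ⊕ (Σ n, L.Functions n)) :=
  (subtermAt t p).map root

theorem root_eq_inl {t : L.Term α} {x : α} : root t = .inl x ↔ t = Term.var x := by
  cases t <;> simp [root]

theorem rootAt_eq_inl {t : L.Term α} {x : α} {p : Position} :
    rootAt t p = some (.inl x) ↔ subtermAt t p = some (Term.var x) := by
  simp [rootAt, Option.map_eq_some_iff, root_eq_inl]

theorem root_subst {t : L.Term α} {g : Σ n, L.Functions n} (h : root t = .inr g)
    (σ : α → L.Term β) : root (t.subst σ) = .inr g := by
  cases t with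
  | var => cases h
  | func => exact Sum.inr.inj h ▸ rfl

theorem rootAt_subst {t : L.Term α} {g : Σ n, L.Functions n} {p : Position}
    (h : rootAt t p = some (.inr g)) (σ : α → L.Term β) :
    rootAt (t.subst σ) p = some (.inr g) := by
  obtain ⟨u, hu, hg⟩ := Option.map_eq_some_iff.1 h
  exact Option.map_eq_some_iff.2 ⟨_, subtermAt_subst hu σ, root_subst hg σ⟩

theorem rootAt_append_of_eq_some {t u : L.Term α} {p : Position} (h : subtermAt t p = some u)
    (q : Position) : rootAt t (p ++ q) = rootAt u q := by
  rw [rootAt, rootAt, subtermAt_append_of_eq_some h]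

/-! ### Matching -/

/-- `ℓ` matches `u`. -/
def Matches (ℓ : L.Term α) (u : L.Term β) : Prop := ∃ σ : α → L.Term β, u = ℓ.subst σ

theorem Matches.subst {ℓ : L.Term α} {u : L.Term β} (h : Matches ℓ u) (σ : β → L.Term γ) :
    Matches ℓ (u.subst σ) := by
  obtain ⟨τ, rfl⟩ := h
  exact ⟨_, term_subst_subst _ _ _⟩

/-- Every function symbol of `ℓ` occurs in `u` at the same position. -/
def SkeletonLE (ℓ : L.Term α) (u : L.Term β) : Prop :=
  ∀ p g, rootAt ℓ p = some (.inr g) → rootAt u p = some (.inr g)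

theorem SkeletonLE.exists_func {n : ℕ} {f : L.Functions n} {ts : Fin n → L.Term α} {u : L.Term β}
    (h : SkeletonLE (Term.func f ts) u) :
    ∃ us : Fin n → L.Term β, u = Term.func f us ∧ ∀ i, SkeletonLE (ts i) (us i) := by
  have h0 := h [] ⟨n, f⟩ (by simp [rootAt, root])
  cases u with
  | var => simp [rootAt, root] at h0
  | @func n' f' us =>
    simp only [rootAt, subtermAt_nil, Option.map_some, root, Option.some.injEq, Sum.inr.injEq,
      Sigma.mk.injEq] at h0
    obtain ⟨rfl, h0⟩ := h0
    obtain rfl := eq_of_heq h0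
    refine ⟨us, rfl, fun i p g hp => ?_⟩
    have := h (i :: p) g
    simp only [rootAt, subtermAt_func_cons_of_lt _ _ i.2] at this
    exact this hp

theorem SkeletonLE.exists_subtermAt {ℓ : L.Term α} {u : L.Term β} (h : SkeletonLE ℓ u)
    {p : Position} {s : L.Term α} (hs : subtermAt ℓ p = some s) : ∃ v, subtermAt u p = some v := by
  induction p generalizing ℓ u with
  | nil => exact ⟨u, by simp⟩
  | cons i p ih =>
    obtain ⟨n, f, ts, hi, rfl, hs'⟩ := exists_func_of_subtermAt_cons hs
    obtain ⟨us, rfl, hus⟩ := h.exists_func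
    rw [subtermAt_func_cons_of_lt _ _ hi]
    exact ih (hus _) hs'

theorem SkeletonLE.eq_subst {ℓ : L.Term α} {u : L.Term β} (h : SkeletonLE ℓ u) (σ : α → L.Term β)
    (hσ : ∀ p x, subtermAt ℓ p = some (Term.var x) → subtermAt u p = some (σ x)) :
    u = ℓ.subst σ := by
  induction ℓ generalizing u with
  | var x => simpa using hσ [] x (by simp)
  | func f ts ih =>
    obtain ⟨us, rfl, hus⟩ := h.exists_func
    refine congrArg _ (funext fun i => ih i (hus i) fun p x hp => ?_)
    have := hσ (i :: p) x
    rw [subtermAt_func_cons_of_lt _ _ i.2, subtermAt_func_cons_of_lt _ _ i.2] at this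
    exact this hp

/-- Eliminates the matching substitution. The two conditions, on function symbols and on repeated
variables, stabilize separately under iteration, and both can be checked by bounded search. -/
theorem matches_iff {ℓ : L.Term α} {u : L.Term β} : Matches ℓ u ↔ SkeletonLE ℓ u ∧
    ∀ p q x, subtermAt ℓ p = some (Term.var x) → subtermAt ℓ q = some (Term.var x) →
      subtermAt u p = subtermAt u q := by
  classical
  constructor
  · rintro ⟨σ, rfl⟩
    exact ⟨fun p g h => rootAt_subst h σ, fun p q x hp hq => by
      rw [subtermAt_subst hp, subtermAt_subst hq]⟩
  · rintro ⟨h, hv⟩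
    have : ∀ x, ∃ v, ∀ p, subtermAt ℓ p = some (Term.var x) → subtermAt u p = some v := by
      intro x
      by_cases hx : ∃ p, subtermAt ℓ p = some (Term.var x)
      · obtain ⟨p, hp⟩ := hx
        obtain ⟨v, hv'⟩ := h.exists_subtermAt hp
        exact ⟨v, fun q hq => hv p q x hp hq ▸ hv'⟩
      · exact ⟨u, fun p hp => (hx ⟨p, hp⟩).elim⟩
    choose σ hσ using this
    exact ⟨σ, h.eq_subst σ fun p x => hσ x p⟩

/-! ### Iterated substitutions -/

/-- The term `t μ ^ k`. -/
def substIter (μ : α → L.Term α) (k : ℕ) (t : L.Term α) : L.Term α := (fun s => s.subst μ)^[k] t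

variable {μ : α → L.Term α}

@[simp] theorem substIter_zero (t : L.Term α) : substIter μ 0 t = t := rfl

theorem substIter_succ (k : ℕ) (t : L.Term α) :
    substIter μ (k + 1) t = substIter μ k (t.subst μ) := rfl

theorem substIter_succ' (k : ℕ) (t : L.Term α) :
    substIter μ (k + 1) t = (substIter μ k t).subst μ :=
  Function.iterate_succ_apply' _ _ _

theorem substIter_add (j k : ℕ) (t : L.Term α) :
    substIter μ (j + k) t = substIter μ j (substIter μ k t) :=
  Function.iterate_add_apply _ _ _ _

theorem substIter_eq_subst (k : ℕ) (t : L.Term α) :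
    substIter μ k t = t.subst fun x => substIter μ k (Term.var x) := by
  induction k generalizing t with
  | zero => exact (term_subst_var t).symm
  | succ k ih =>
    rw [substIter_succ, ih, term_subst_subst]
    exact congrArg _ (funext fun x => by rw [substIter_succ, ← ih]; rfl)

theorem substIter_func (k : ℕ) {n : ℕ} (f : L.Functions n) (ts : Fin n → L.Term α) :
    substIter μ k (Term.func f ts) = Term.func f fun i => substIter μ k (ts i) := by
  rw [substIter_eq_subst, Term.subst]
  exact congrArg _ (funext fun i => (substIter_eq_subst _ _).symm)

theorem subtermAt_substIter {t u : L.Term α} {p : Position} (h : subtermAt t p = some u) (k : ℕ) :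
    subtermAt (substIter μ k t) p = some (substIter μ k u) := by
  rw [substIter_eq_subst, subtermAt_subst h, ← substIter_eq_subst]

theorem Matches.substIter {ℓ : L.Term β} {u : L.Term α} (h : Matches ℓ u) (k : ℕ) :
    Matches ℓ (substIter μ k u) := by
  rw [substIter_eq_subst]
  exact h.subst _

theorem substIter_var_of_eq {x : α} (h : μ x = Term.var x) (k : ℕ) :
    substIter μ k (Term.var x) = Term.var x := by
  induction k with
  | zero => rfl
  | succ k ih => rw [substIter_succ]; exact (congrArg _ h).trans ih

theorem substIter_eq_of_le {s t : L.Term α} {j k : ℕ} (hjk : j ≤ k)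
    (h : substIter μ j s = substIter μ j t) : substIter μ k s = substIter μ k t := by
  obtain ⟨i, rfl⟩ := Nat.exists_eq_add_of_le' hjk
  rw [substIter_add, substIter_add, h]

/-- A sequence of numbers that does not increase stays the same for one of its first steps. -/
theorem exists_le_eq_succ {f : ℕ → ℕ} {b : ℕ} (h0 : f 0 ≤ b) (h : ∀ k, f (k + 1) ≤ f k) :
    ∃ k ≤ b, f (k + 1) = f k := by
  by_contra! hne
  have key : ∀ k ≤ b + 1, f k + k ≤ b := by
    intro k
    induction k with
    | zero => intro _; omega
    | succ k ih =>
      intro hk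
      have := ih (by omega)
      have := h k
      have := hne k (by omega)
      omega
  have := key (b + 1) le_rfl
  omega

/-- A sequence of sets that arises by taking preimages is constant once two successive sets
coincide. -/
theorem mem_iff_of_preimage {ι : Type*} {X : ℕ → Set ι} {F : ι → ι}
    (hF : ∀ k a, a ∈ X (k + 1) ↔ F a ∈ X k) {j : ℕ} (hj : X (j + 1) = X j) {k : ℕ} (hk : j ≤ k)
    (a : ι) : a ∈ X k ↔ a ∈ X j := by
  induction k, hk using Nat.le_induction generalizing a with
  | base => rfl
  | succ k _ ih => rw [hF, ih, ← hF, hj]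

/-! ### Bounds on the power of a substitution in identity and matching problems -/

section Identity

variable (μ) (D : Finset α)

/-- The instances of terms by `μ ^ k` that are not composed of such instances. -/
def IsIrreducibleInstance (k : ℕ) (a : L.Term α) : Prop :=
  a ∈ Set.range (substIter μ k) ∧
    ∀ (n : ℕ) (f : L.Functions n) (ts : Fin n → L.Term α), a = Term.func f ts →
      ¬ ∀ i, ts i ∈ Set.range (substIter μ k)

variable {μ} in
theorem not_isIrreducibleInstance {k : ℕ} {a : L.Term α} (ha : a ∈ Set.range (substIter μ k)) :
    ¬ IsIrreducibleInstance μ k a → ∃ (n : ℕ) (f : L.Functions n) (ts : Fin n → L.Term α),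
      a = Term.func f ts ∧ ∀ i, ts i ∈ Set.range (substIter μ k) := by
  intro h
  by_contra! hne
  exact h ⟨ha, fun n f ts he hts => (hne n f ts he).elim fun i hi => hi (hts i)⟩

open Classical in
/-- The irreducible instances by `μ ^ k` that are not variables outside of `D`. -/
noncomputable def generators (k : ℕ) : Finset (L.Term α) :=
  (D.image fun x => substIter μ k (Term.var x)).filter fun a =>
    IsIrreducibleInstance μ k a ∧ ∀ x ∉ D, a ≠ Term.var x

variable {μ} {D} (hμ : ∀ x ∉ D, μ x = Term.var x)
include hμ

/-- If `a = s μ^k` with `s` not a variable, then the arguments of `a` are themselves instances. So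
`s` is a variable, and it is fixed by `μ` unless it lies in `D`. -/
theorem IsIrreducibleInstance.cases {k : ℕ} {a : L.Term α} (h : IsIrreducibleInstance μ k a) :
    a ∈ generators μ D k ∨ ∃ x ∉ D, a = Term.var x := by
  classical
  by_cases hx : ∃ x ∉ D, a = Term.var x
  · exact .inr hx
  · push Not at hx
    refine .inl (Finset.mem_filter.2 ⟨?_, h, hx⟩)
    obtain ⟨s, rfl⟩ := h.1
    cases s with
    | var x =>
      by_cases hxD : x ∈ D
      · exact Finset.mem_image_of_mem _ hxD
      · exact (hx x hxD (substIter_var_of_eq (hμ x hxD) k)).elim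
    | func f ts =>
      exact (h.2 _ _ _ (substIter_func k f ts) fun i => ⟨ts i, rfl⟩).elim

-- A decomposition of `x μ^k` into instances by `μ^k` becomes, after one more `μ`, a decomposition
-- of `x μ^(k+1)`. So a generator can only come from a generator.
open Classical in
theorem generators_succ_subset (k : ℕ) :
    generators μ D (k + 1) ⊆ (generators μ D k).image fun a => a.subst μ := by
  intro a ha
  obtain ⟨hD, hirr, hx⟩ := Finset.mem_filter.1 ha
  obtain ⟨x, hxD, rfl⟩ := Finset.mem_image.1 hD
  rw [Finset.mem_image]
  refine ⟨substIter μ k (Term.var x), Finset.mem_filter.2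
    ⟨Finset.mem_image_of_mem _ hxD, ⟨⟨_, rfl⟩, fun n f ts he hts => ?_⟩, fun y hy he => ?_⟩,
    (substIter_succ' _ _).symm⟩
  · refine hirr.2 n f (fun i => (ts i).subst μ) (by rw [substIter_succ', he]; rfl) fun i => ?_
    obtain ⟨s, hs⟩ := hts i
    exact ⟨s, by rw [substIter_succ', hs]⟩
  · refine hx y hy ?_
    rw [substIter_succ', he]
    exact hμ y hy

/-- Equal cardinalities make `μ` a bijection between successive sets of generators. An injective map
of generators to generators extends injectively to the freely generated terms. -/
theorem subst_injOn_of_card_eq {k : ℕ}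
    (hcard : (generators μ D (k + 1)).card = (generators μ D k).card) {a b : L.Term α}
    (ha : a ∈ Set.range (substIter μ k)) (hb : b ∈ Set.range (substIter μ k))
    (hab : a.subst μ = b.subst μ) : a = b := by
  classical
  have himg : generators μ D (k + 1) = (generators μ D k).image fun a => a.subst μ :=
    Finset.eq_of_subset_of_card_le (generators_succ_subset hμ k)
      (Finset.card_image_le.trans hcard.ge)
  have hinj : Set.InjOn (fun a : L.Term α => a.subst μ) (generators μ D k) :=
    Finset.card_image_iff.1 (by rw [← himg, hcard])
  have hmem : ∀ a ∈ generators μ D k, a.subst μ ∈ generators μ D (k + 1) := fun a ha =>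
    himg ▸ Finset.mem_image_of_mem _ ha
  -- A generator stays irreducible under `μ`, while a composed instance stays composed, so `μ`
  -- cannot identify the two.
  have hmixed : ∀ {a b : L.Term α}, IsIrreducibleInstance μ k a →
      b ∈ Set.range (substIter μ k) → ¬ IsIrreducibleInstance μ k b → a.subst μ ≠ b.subst μ := by
    intro a b ha hb hnb hab
    obtain ⟨n, f, ts, rfl, hts⟩ := not_isIrreducibleInstance hb hnb
    obtain ha | ⟨x, hx, rfl⟩ := ha.cases hμ
    · refine (Finset.mem_filter.1 (hmem a ha)).2.1.2 n f (fun i => (ts i).subst μ) hab fun i => ?_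
      obtain ⟨s, hs⟩ := hts i
      exact ⟨s, by rw [substIter_succ', hs]⟩
    · rw [Term.subst, hμ x hx] at hab
      cases hab
  have hgen : ∀ {a : L.Term α} {x : α}, a ∈ generators μ D k → x ∉ D →
      a.subst μ ≠ (Term.var x).subst μ := by
    intro a x ha hx he
    exact (Finset.mem_filter.1 (hmem a ha)).2.2 x hx (he.trans (hμ x hx))
  have hirr : ∀ {a b : L.Term α}, IsIrreducibleInstance μ k a → IsIrreducibleInstance μ k b →
      a.subst μ = b.subst μ → a = b := by
    intro a b ha hb hab
    obtain ha | ⟨x, hx, rfl⟩ := ha.cases hμ <;> obtain hb | ⟨y, hy, rfl⟩ := hb.cases hμ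
    · exact hinj ha hb hab
    · exact (hgen ha hy hab).elim
    · exact (hgen hb hx hab.symm).elim
    · rwa [Term.subst, Term.subst, hμ x hx, hμ y hy] at hab
  induction a generalizing b with
  | var x =>
    have hia : IsIrreducibleInstance μ k (Term.var x) := ⟨ha, fun _ _ _ h => by cases h⟩
    by_cases hib : IsIrreducibleInstance μ k b
    · exact hirr hia hib hab
    · exact (hmixed hia hb hib hab).elim
  | @func n f ts ih =>
    by_cases hia : IsIrreducibleInstance μ k (Term.func f ts) <;>
      by_cases hib : IsIrreducibleInstance μ k b
    · exact hirr hia hib hab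
    · exact (hmixed hia hb hib hab).elim
    · exact (hmixed hib ha hia hab.symm).elim
    · obtain ⟨n', g, us, rfl, hus⟩ := not_isIrreducibleInstance hb hib
      obtain ⟨n'', f', ts', he, hts⟩ := not_isIrreducibleInstance ha hia
      obtain ⟨rfl, hf, ht⟩ := Term.func.inj he
      obtain rfl := eq_of_heq ht
      simp only [Term.subst, Term.func.injEq] at hab
      obtain ⟨rfl, hfg, hab⟩ := hab
      obtain rfl := eq_of_heq hfg
      exact congrArg _ (funext fun i => ih i (hts i) (hus i) (congrFun (eq_of_heq hab) i))

/-- Whether two terms are identified by a power of a substitution is decided by the power given by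
the size of its domain. -/
theorem substIter_card_eq {k : ℕ} {s t : L.Term α} (h : substIter μ k s = substIter μ k t) :
    substIter μ D.card s = substIter μ D.card t := by
  classical
  obtain ⟨j, hj, hcard⟩ := exists_le_eq_succ (f := fun k => (generators μ D k).card)
    ((Finset.card_filter_le _ _).trans Finset.card_image_le) fun k =>
      (Finset.card_le_card (generators_succ_subset hμ k)).trans Finset.card_image_le
  -- The pairs identified by `μ^(k+1)` are the preimage of those identified by `μ^k`, so one stall
  -- suffices for all later exponents.
  have hstab := mem_iff_of_preimage (k := max j k)
    (X := fun k => {p : L.Term α × L.Term α | substIter μ k p.1 = substIter μ k p.2})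
    (F := fun p => (p.1.subst μ, p.2.subst μ)) (j := j) (fun k p => Iff.rfl) (by
      ext p
      simp only [Set.mem_ofPred_eq, substIter_succ']
      exact ⟨subst_injOn_of_card_eq hμ hcard ⟨_, rfl⟩ ⟨_, rfl⟩, fun h => by rw [h]⟩)
  refine substIter_eq_of_le hj ((hstab (le_max_left j k) (s, t)).1 ?_)
  exact substIter_eq_of_le (le_max_right j k) h

/-- The variables of `D` that are still sent to variables by `μ^k` form a decreasing family of sets.
It stalls within `D.card` steps, and after that no variable turns into a compound term. -/
theorem substIter_card_ne_var {k : ℕ} {s : L.Term α} (h : ∀ x, substIter μ k s ≠ Term.var x)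
    (x : α) : substIter μ D.card s ≠ Term.var x := by
  classical
  have hmono : ∀ (j k : ℕ), j ≤ k → ∀ s : L.Term α, (∀ x, substIter μ j s ≠ Term.var x) →
      ∀ x, substIter μ k s ≠ Term.var x := by
    intro j k hjk s hs x hx
    obtain ⟨i, rfl⟩ := Nat.exists_eq_add_of_le' hjk
    rw [substIter_add] at hx
    cases hj : substIter μ j s with
    | var y => exact hs y hj
    | func f ts => rw [hj, substIter_func] at hx; cases hx
  let V : ℕ → Finset α := fun k => D.filter fun x => ∃ y, substIter μ k (Term.var x) = Term.var y
  have hsub : ∀ k, V (k + 1) ⊆ V k := by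
    intro k x hx
    obtain ⟨hxD, y, hy⟩ := Finset.mem_filter.1 hx
    refine Finset.mem_filter.2 ⟨hxD, ?_⟩
    by_contra! hne
    exact hmono k (k + 1) k.le_succ _ hne y hy
  obtain ⟨j, hj, hcard⟩ := exists_le_eq_succ (f := fun k => (V k).card)
    (Finset.card_filter_le _ _) fun k => Finset.card_le_card (hsub k)
  have hV : V (j + 1) = V j := Finset.eq_of_subset_of_card_le (hsub j) hcard.ge
  have hstab := mem_iff_of_preimage (k := max j k)
    (X := fun k => {s : L.Term α | ∀ x, substIter μ k s ≠ Term.var x})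
    (F := fun s => s.subst μ) (j := j) (fun k p => Iff.rfl) (by
      ext s
      refine ⟨fun hs x hx => ?_, hmono j (j + 1) j.le_succ s⟩
      cases s with
      | func f ts => rw [substIter_func] at hx; cases hx
      | var y =>
        by_cases hy : y ∈ D
        · have : y ∈ V (j + 1) := hV ▸ Finset.mem_filter.2 ⟨hy, x, hx⟩
          obtain ⟨_, z, hz⟩ := Finset.mem_filter.1 this
          exact hs z hz
        · exact hs y (substIter_var_of_eq (hμ y hy) _))
  exact hmono j _ hj s
    ((hstab (le_max_left j k) s).1 (hmono k _ (le_max_right j k) s h)) x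

/-- Each level of the position costs at most `D.card` iterations to expose its symbol; a symbol once
exposed never changes. -/
theorem rootAt_substIter_of_le {k K : ℕ} {s : L.Term α} {p : Position} {g : Σ n, L.Functions n}
    (h : rootAt (substIter μ k s) p = some (.inr g)) (hK : (p.length + 1) * D.card ≤ K) :
    rootAt (substIter μ K s) p = some (.inr g) := by
  have hmono : ∀ {j k : ℕ} {s : L.Term α} {p : Position}, j ≤ k →
      rootAt (substIter μ j s) p = some (.inr g) → rootAt (substIter μ k s) p = some (.inr g) := by
    intro j k s p hjk hs
    obtain ⟨i, rfl⟩ := Nat.exists_eq_add_of_le' hjk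
    rw [substIter_add, substIter_eq_subst]
    exact rootAt_subst hs _
  induction p generalizing s K with
  | nil =>
    refine hmono (j := D.card) (by simpa using hK) ?_
    have hne : ∀ x, substIter μ D.card s ≠ Term.var x := substIter_card_ne_var hμ (k := k)
      (fun x hx => by rw [hx] at h; simp [rootAt, root] at h)
    obtain ⟨n, f, ts, hs⟩ : ∃ (n : ℕ) (f : L.Functions n) (ts : Fin n → L.Term α),
        substIter μ D.card s = Term.func f ts := by
      cases hs : substIter μ D.card s with
      | var x => exact (hne x hs).elim
      | func f ts => exact ⟨_, f, ts, rfl⟩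
    -- Raising the exponent to `k + D.card` allows `μ ^ D.card` to be applied first, which already
    -- exposes the root.
    have h' := hmono (Nat.le_add_right k D.card) h
    rw [substIter_add, hs, substIter_func] at h'
    rw [hs]
    exact h'
  | cons i p ih =>
    have hne : ∀ x, substIter μ D.card s ≠ Term.var x := substIter_card_ne_var hμ (k := k)
      (fun x hx => by rw [hx] at h; simp [rootAt] at h)
    obtain ⟨n, f, ts, hs⟩ : ∃ (n : ℕ) (f : L.Functions n) (ts : Fin n → L.Term α),
        substIter μ D.card s = Term.func f ts := by
      cases hs : substIter μ D.card s with
      | var x => exact (hne x hs).elim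
      | func f ts => exact ⟨_, f, ts, rfl⟩
    have h' := hmono (Nat.le_add_right k D.card) h
    have hK' : D.card + (p.length + 1) * D.card ≤ K := by
      simp only [List.length_cons] at hK; nlinarith
    obtain ⟨K, rfl⟩ := Nat.exists_eq_add_of_le' ((Nat.le_add_right _ _).trans hK')
    rw [substIter_add, hs, substIter_func, rootAt, subtermAt_func_cons] at h' ⊢
    split_ifs at h' ⊢ with hi
    · exact ih h' (by omega)
    · simp at h'

/-- If a power of a substitution makes an instance of `ℓ` out of `s`, then so does a power that
depends only on the size of its domain and the depth of `ℓ`. -/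
theorem matches_substIter_of_le {ℓ : L.Term β} {s : L.Term α} {k K d : ℕ}
    (h : Matches ℓ (substIter μ k s)) (hd : ∀ p u, subtermAt ℓ p = some u → p.length ≤ d)
    (hK : (d + 2) * D.card ≤ K) : Matches ℓ (substIter μ K s) := by
  have hroot : ∀ K', (d + 1) * D.card ≤ K' → SkeletonLE ℓ (substIter μ K' s) := by
    intro K' hK' p g hp
    obtain ⟨u, hu, -⟩ := Option.map_eq_some_iff.1 hp
    exact rootAt_substIter_of_le hμ ((matches_iff.1 h).1 p g hp)
      ((Nat.mul_le_mul_right _ (Nat.succ_le_succ (hd p u hu))).trans hK')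
  rw [matches_iff]
  refine ⟨hroot K (le_trans (Nat.mul_le_mul_right _ (Nat.le_succ _)) hK), fun p q x hp hq => ?_⟩
  -- The first `(d + 1) * D.card` iterations expose all of `ℓ`; a further `D.card` identify the
  -- subterms at repeated variables.
  have h' := h.substIter (μ := μ) ((d + 1) * D.card)
  rw [← substIter_add, add_comm, substIter_add] at h'
  obtain ⟨a, ha⟩ := (hroot _ le_rfl).exists_subtermAt hp
  obtain ⟨b, hb⟩ := (hroot _ le_rfl).exists_subtermAt hq
  have hab := (matches_iff.1 h').2 p q x hp hq
  rw [subtermAt_substIter ha, subtermAt_substIter hb, Option.some_inj] at hab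
  have hK' : D.card + (d + 1) * D.card ≤ K := by nlinarith
  obtain ⟨i, rfl⟩ := Nat.exists_eq_add_of_le' hK'
  rw [← add_assoc, substIter_add, subtermAt_substIter ha, subtermAt_substIter hb,
    substIter_add, substIter_add, substIter_card_eq hμ hab]

end Identity

end Terms

/-! ### Towers of contexts and lifted rewrite steps -/

section Contexts

variable {L : FirstOrder.Language.{u, v}} {α β : Type*}

theorem subst_congr {c : L.Term α} {f g : α → L.Term β}
    (h : ∀ p x, subtermAt c p = some (Term.var x) → f x = g x) : c.subst f = c.subst g := by
  induction c with
  | var x => exact h [] x (by simp)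
  | func F ts ih =>
    refine congrArg (Term.func F) (funext fun i => ih i fun p x hp => h (i :: p) x ?_)
    rwa [subtermAt_func_cons_of_lt _ _ i.2]

/-- Two terms with the same symbols outside of the subterms at the position `p`. -/
def DifferOnlyAt : Position → L.Term α → L.Term α → Prop
  | [], _, _ => True
  | i :: p, s, t => ∃ (n : ℕ) (f : L.Functions n) (ss ts : Fin n → L.Term α) (hi : i < n),
      s = Term.func f ss ∧ t = Term.func f ts ∧ (∀ j, j.1 ≠ i → ss j = ts j) ∧
        DifferOnlyAt p (ss ⟨i, hi⟩) (ts ⟨i, hi⟩)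

theorem DifferOnlyAt.subst {p : Position} {s t : L.Term α} (h : DifferOnlyAt p s t)
    (σ : α → L.Term β) : DifferOnlyAt p (s.subst σ) (t.subst σ) := by
  induction p generalizing s t with
  | nil => trivial
  | cons i p ih =>
    obtain ⟨n, f, ss, ts, hi, rfl, rfl, hj, h⟩ := h
    exact ⟨n, f, _, _, hi, rfl, rfl, fun j hji => congrArg (Term.subst · σ) (hj j hji), ih h⟩

theorem DifferOnlyAt.append {p q : Position} {s t s' t' : L.Term α} (h : DifferOnlyAt p s t)
    (hs : subtermAt s p = some s') (ht : subtermAt t p = some t') (h' : DifferOnlyAt q s' t') :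
    DifferOnlyAt (p ++ q) s t := by
  induction p generalizing s t with
  | nil =>
    simp only [subtermAt_nil, Option.some.injEq] at hs ht
    rwa [List.nil_append, hs, ht]
  | cons i p ih =>
    obtain ⟨n, f, ss, ts, hi, rfl, rfl, hj, h⟩ := h
    rw [subtermAt_func_cons_of_lt _ _ hi] at hs ht
    exact ⟨n, f, _, _, hi, rfl, rfl, hj, ih h hs ht⟩

theorem DifferOnlyAt.subtermAt_eq {p w : Position} {s t : L.Term α} (h : DifferOnlyAt p s t)
    (hpw : ¬ p <+: w) (hwp : ¬ w <+: p) : subtermAt s w = subtermAt t w := by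
  induction p generalizing s t w with
  | nil => exact (hpw List.nil_prefix).elim
  | cons i p ih =>
    obtain ⟨n, f, ss, ts, hi, rfl, rfl, hj, h⟩ := h
    cases w with
    | nil => exact (hwp List.nil_prefix).elim
    | cons j w =>
      by_cases hji : j = i
      · subst hji
        rw [subtermAt_func_cons_of_lt _ _ hi, subtermAt_func_cons_of_lt _ _ hi]
        exact ih h (by simpa [List.cons_prefix_cons] using hpw)
          (by simpa [List.cons_prefix_cons] using hwp)
      · rw [subtermAt_func_cons, subtermAt_func_cons]
        split_ifs with hjn
        · rw [hj ⟨j, hjn⟩ hji]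
        · rfl

theorem DifferOnlyAt.rootAt_eq {p w : Position} {s t : L.Term α} (h : DifferOnlyAt p s t)
    (hpw : ¬ p <+: w) : rootAt s w = rootAt t w := by
  induction p generalizing s t w with
  | nil => exact (hpw List.nil_prefix).elim
  | cons i p ih =>
    obtain ⟨n, f, ss, ts, hi, rfl, rfl, hj, h⟩ := h
    cases w with
    | nil => rfl
    | cons j w =>
      by_cases hji : j = i
      · subst hji
        rw [rootAt, rootAt, subtermAt_func_cons_of_lt _ _ hi, subtermAt_func_cons_of_lt _ _ hi]
        exact ih h (by simpa [List.cons_prefix_cons] using hpw)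
      · rw [rootAt, rootAt, subtermAt_func_cons, subtermAt_func_cons]
        split_ifs with hjn
        · rw [hj ⟨j, hjn⟩ hji]
        · rfl

theorem differOnlyAt_subst {c u : L.Term α} {p : Position} (hp : subtermAt c p = some u)
    {f g : α → L.Term β}
    (h : ∀ q x, subtermAt c q = some (Term.var x) → q ≠ p → f x = g x) :
    DifferOnlyAt p (c.subst f) (c.subst g) := by
  induction p generalizing c with
  | nil => trivial
  | cons i p ih =>
    obtain ⟨n, F, ts, hi, rfl, hp'⟩ := exists_func_of_subtermAt_cons hp
    refine ⟨n, F, _, _, hi, rfl, rfl, fun j hj => subst_congr fun q x hq => h (j :: q) x ?_ ?_,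
      ih hp' fun q x hq hne => h (i :: q) x ?_ ?_⟩
    · rwa [subtermAt_func_cons_of_lt _ _ j.2]
    · simp [hj]
    · rwa [subtermAt_func_cons_of_lt _ _ hi]
    · simpa using hne

theorem Position.pow_succ (p : Position) (n : ℕ) : p.pow (n + 1) = p ++ p.pow n := by
  simp [Position.pow, List.replicate_succ]

theorem Position.pow_add (p : Position) (m n : ℕ) : p.pow (m + n) = p.pow m ++ p.pow n := by
  rw [Position.pow, List.replicate_add, List.flatten_append]; rfl

theorem Position.length_pow (p : Position) (n : ℕ) : (p.pow n).length = n * p.length := by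
  simp [Position.pow]

theorem Position.pow_prefix_pow (p : Position) {m n : ℕ} (h : m ≤ n) : p.pow m <+: p.pow n := by
  obtain ⟨k, rfl⟩ := Nat.exists_eq_add_of_le h
  rw [Position.pow_add]
  exact List.prefix_append _ _

theorem Context.HoleAt.subtermAt_fill {C : Context L} {p : Position} (h : C.HoleAt p)
    (t : L.Term ℕ) : subtermAt (C.fill t) p = some t :=
  subtermAt_subst (t := C.toTerm) h _

theorem Context.HoleAt.differOnlyAt_fill {C : Context L} {p : Position} (h : C.HoleAt p)
    (s t : L.Term ℕ) : DifferOnlyAt p (C.fill s) (C.fill t) := by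
  refine differOnlyAt_subst h fun q x hq hne => ?_
  cases x with
  | none => exact (hne (C.existsUnique_hole.unique hq h)).elim
  | some x => rfl

/-- The context `C[C'μ]`. -/
def Context.compSubst (C C' : Context L) (μ : ℕ → L.Term ℕ) : Context L where
  toTerm := C.toTerm.subst fun x => x.elim
    (C'.toTerm.subst fun y => y.elim (Term.var none) fun z => (μ z).subst (Term.var ∘ some))
    (Term.var ∘ some)
  existsUnique_hole := by
    obtain ⟨p, hp, hpu⟩ := C.existsUnique_hole
    obtain ⟨q, hq, hqu⟩ := C'.existsUnique_hole
    refine ⟨p ++ q, ?_, fun w hw => ?_⟩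
    · have := subtermAt_subst hp fun x => x.elim
        (C'.toTerm.subst fun y => y.elim (Term.var none) fun z => (μ z).subst (Term.var ∘ some))
        (Term.var ∘ some)
      refine (subtermAt_append_of_eq_some this q).trans ?_
      exact subtermAt_subst hq _
    · have hrename : ∀ (t : L.Term ℕ) (v : Position),
          subtermAt (t.subst (Term.var ∘ some : ℕ → L.Term (Option ℕ))) v ≠
            some (Term.var none) := by
        intro t v hv
        obtain ⟨s, -, hs⟩ | ⟨v₁, v₂, x, -, -, hx⟩ := subtermAt_subst_cases hv
        · cases s <;> simp [Term.subst] at hs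
        · cases v₂ <;> simp at hx
      have hcases : ∀ {c : L.Term (Option ℕ)} {f : Option ℕ → L.Term (Option ℕ)} {w : Position},
          (∀ x v, subtermAt (f (some x)) v ≠ some (Term.var none)) →
          subtermAt (c.subst f) w = some (Term.var none) →
          ∃ w₁ w₂, w = w₁ ++ w₂ ∧ subtermAt c w₁ = some (Term.var none) ∧
            subtermAt (f none) w₂ = some (Term.var none) := by
        intro c f w hf hw
        obtain ⟨s, h₁, hs⟩ | ⟨w₁, w₂, x, rfl, h₁, h₂⟩ := subtermAt_subst_cases hw
        · cases s with
          | func => simp [Term.subst] at hs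
          | var x =>
            cases x with
            | none => exact ⟨w, [], by simp, h₁, by simpa using hs.symm⟩
            | some x => exact (hf x [] (by simpa using hs.symm)).elim
        · cases x with
          | none => exact ⟨w₁, w₂, rfl, h₁, h₂⟩
          | some x => exact (hf x _ h₂).elim
      obtain ⟨w₁, w₂, rfl, h₁, h₂⟩ := hcases (fun x v hv => by cases v <;> simp at hv) hw
      obtain ⟨w₃, w₄, rfl, h₃, h₄⟩ := hcases (fun x v => hrename _ _) h₂
      cases w₄ with
      | cons => simp at h₄
      | nil => rw [List.append_nil, hpu w₁ h₁, hqu w₃ h₃]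

theorem Context.holeAt_compSubst {C C' : Context L} {p q : Position} (hp : C.HoleAt p)
    (hq : C'.HoleAt q) (μ : ℕ → L.Term ℕ) : (C.compSubst C' μ).HoleAt (p ++ q) :=
  (subtermAt_append_of_eq_some (subtermAt_subst hp _) q).trans (subtermAt_subst hq _)

theorem Context.fill_compSubst (C C' : Context L) (μ : ℕ → L.Term ℕ) (t : L.Term ℕ) :
    (C.compSubst C' μ).fill (t.subst μ) = C.fill ((C'.fill t).subst μ) := by
  simp only [Context.fill, Context.compSubst, term_subst_subst]
  refine congrArg _ (funext fun x => ?_)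
  cases x with
  | some x => rfl
  | none =>
    simp only [Option.elim, term_subst_subst]
    refine congrArg _ (funext fun y => ?_)
    cases y with
    | none => rfl
    | some y =>
      simp only [term_subst_subst]
      exact term_subst_var _

theorem Step.fill_subst {R : TRS L} {q : Position} {t s : L.Term ℕ} (h : Step R q t s)
    {C : Context L} {p : Position} (hp : C.HoleAt p) (μ : ℕ → L.Term ℕ) :
    Step R (p ++ q) (C.fill (t.subst μ)) (C.fill (s.subst μ)) := by
  obtain ⟨ρ, hρ, σ, C', hq, rfl, rfl⟩ := h
  refine ⟨ρ, hρ, fun x => (σ x).subst μ, C.compSubst C' μ, Context.holeAt_compSubst hp hq μ, ?_, ?_⟩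
    <;> rw [← term_subst_subst, Context.fill_compSubst]

theorem Step.ctxSubst {R : TRS L} {q : Position} {t s : L.Term ℕ} (h : Step R q t s)
    {C : Context L} {p : Position} (hp : C.HoleAt p) (μ : FinSubst L) (n : ℕ) :
    Step R (p.pow n ++ q) (ctxSubst C μ t n) (ctxSubst C μ s n) := by
  induction n with
  | zero => exact h
  | succ n ih =>
    rw [Position.pow_succ, List.append_assoc]
    exact ih.fill_subst hp _

/-- Left-hand sides are not variables. Hence no variable position of `t` is a prefix of a redex
position. -/
theorem Step.exists_func {R : TRS L} {q : Position} {t s : L.Term ℕ} (h : Step R q t s) :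
    ∃ (n : ℕ) (f : L.Functions n) (ts : Fin n → L.Term ℕ),
      subtermAt t q = some (Term.func f ts) := by
  obtain ⟨ρ, -, σ, C, hq, rfl, -⟩ := h
  rw [hq.subtermAt_fill]
  cases hl : ρ.lhs with
  | var x => exact (ρ.lhs_ne_var x hl).elim
  | func f ts => exact ⟨_, f, _, rfl⟩

theorem ctxSubst_add (C : Context L) (μ : FinSubst L) (t : L.Term ℕ) (m n : ℕ) :
    ctxSubst C μ t (m + n) = ctxSubst C μ (ctxSubst C μ t n) m := by
  induction m with
  | zero => rw [Nat.zero_add]; rfl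
  | succ m ih => rw [Nat.succ_add, ctxSubst, ih, ctxSubst]

theorem subtermAt_ctxSubst_pow {C : Context L} {p : Position} (hp : C.HoleAt p) (μ : FinSubst L)
    (t : L.Term ℕ) (n : ℕ) :
    subtermAt (ctxSubst C μ t n) (p.pow n) = some (substIter μ.toFun n t) := by
  induction n with
  | zero => exact subtermAt_nil _
  | succ n ih =>
    rw [Position.pow_succ, ctxSubst, subtermAt_append_of_eq_some (hp.subtermAt_fill _),
      subtermAt_subst ih, substIter_succ']

theorem differOnlyAt_ctxSubst {C : Context L} {p : Position} (hp : C.HoleAt p) (μ : FinSubst L)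
    (s t : L.Term ℕ) (n : ℕ) :
    DifferOnlyAt (p.pow n) (ctxSubst C μ s n) (ctxSubst C μ t n) := by
  induction n with
  | zero => trivial
  | succ n ih =>
    rw [Position.pow_succ]
    exact (hp.differOnlyAt_fill _ _).append (hp.subtermAt_fill _) (hp.subtermAt_fill _)
      (ih.subst _)

theorem FinSubst.toFun_eq_var (μ : FinSubst L) (x : ℕ) (hx : x ∉ (μ.map Prod.fst).toFinset) :
    μ.toFun x = Term.var x := by
  have : List.lookup x μ = none := by
    rw [List.lookup_eq_none_iff]
    intro b hb
    have : x ≠ b.1 := by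
      rintro rfl
      exact hx (List.mem_toFinset.2 (List.mem_map_of_mem hb))
    simpa using this
  rw [FinSubst.toFun, this, Option.getD_none]

theorem FinSubst.card_domain_le (μ : FinSubst L) :
    (μ.map Prod.fst).toFinset.card ≤ μ.length :=
  (List.toFinset_card_le _).trans (List.length_map _).le

end Contexts

/-! ### Matching subterms of iterated images of a variable -/

section Reachability

variable {L : FirstOrder.Language.{u, v}} {α β : Type*} {μ : α → L.Term α} {D : Finset α}

/-- `s` is a subterm of `x μ ^ k`. -/
def IsSubtermOfIter (μ : α → L.Term α) (x : α) (k : ℕ) (s : L.Term α) : Prop :=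
  ∃ p, subtermAt (substIter μ k (Term.var x)) p = some s

theorem IsSubtermOfIter.substIter {x : α} {k : ℕ} {s : L.Term α} (h : IsSubtermOfIter μ x k s)
    (j : ℕ) : IsSubtermOfIter μ x (j + k) (substIter μ j s) := by
  obtain ⟨p, hp⟩ := h
  exact ⟨p, by rw [substIter_add]; exact subtermAt_substIter hp j⟩

theorem IsSubtermOfIter.succ {x y : α} {k : ℕ} {s : L.Term α} {p : Position}
    (h : IsSubtermOfIter μ x k (Term.var y)) (hs : subtermAt (μ y) p = some s) :
    IsSubtermOfIter μ x (k + 1) s := by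
  obtain ⟨q, hq⟩ := h
  exact ⟨q ++ p, by
    rw [substIter_succ', subtermAt_append_of_eq_some (subtermAt_subst hq μ)]; exact hs⟩

theorem IsSubtermOfIter.cases {x : α} {k : ℕ} {s : L.Term α} (h : IsSubtermOfIter μ x (k + 1) s) :
    (∃ t, IsSubtermOfIter μ x k t ∧ s = t.subst μ) ∨
      ∃ y p, IsSubtermOfIter μ x k (Term.var y) ∧ subtermAt (μ y) p = some s := by
  obtain ⟨p, hp⟩ := h
  rw [substIter_succ'] at hp
  obtain ⟨t, ht, rfl⟩ | ⟨p₁, p₂, y, -, h₁, h₂⟩ := subtermAt_subst_cases hp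
  · exact .inl ⟨t, ⟨p, ht⟩, rfl⟩
  · exact .inr ⟨y, p₂, ⟨p₁, h₁⟩, h₂⟩

variable (hμ : ∀ x ∉ D, μ x = Term.var x)
include hμ

/-- Variables of the domain that are reachable at all are reachable within as many steps as there
are variables in the domain. -/
theorem IsSubtermOfIter.exists_le_card {x y : α} {k : ℕ} (h : IsSubtermOfIter μ x k (Term.var y))
    (hy : y ∈ D) : ∃ j ≤ D.card, IsSubtermOfIter μ x j (Term.var y) := by
  classical
  -- The variables not yet reached form a decreasing family. When it stalls, the reached ones are
  -- closed under reachability.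
  let U : ℕ → Finset α := fun k => D.filter fun y => ¬ ∃ j ≤ k, IsSubtermOfIter μ x j (Term.var y)
  have hsub : ∀ k, U (k + 1) ⊆ U k := by
    intro k z hz
    obtain ⟨hz, hn⟩ := Finset.mem_filter.1 hz
    exact Finset.mem_filter.2 ⟨hz, fun ⟨j, hj, h⟩ => hn ⟨j, hj.trans k.le_succ, h⟩⟩
  obtain ⟨j, hj, hcard⟩ := exists_le_eq_succ (f := fun k => (U k).card)
    (Finset.card_filter_le _ _) fun k => Finset.card_le_card (hsub k)
  have hU : U (j + 1) = U j := Finset.eq_of_subset_of_card_le (hsub j) hcard.ge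
  have key : ∀ k, ∀ y ∈ D, IsSubtermOfIter μ x k (Term.var y) →
      ∃ i ≤ j, IsSubtermOfIter μ x i (Term.var y) := by
    intro k
    induction k with
    | zero => exact fun y _ h => ⟨0, j.zero_le, h⟩
    | succ k ih =>
      intro y hy h
      obtain ⟨z, p, hz, hp⟩ : ∃ z p, IsSubtermOfIter μ x k (Term.var z) ∧
          subtermAt (μ z) p = some (Term.var y) := by
        obtain ⟨t, ht, he⟩ | h := h.cases
        · cases t with
          | var z => exact ⟨z, [], ht, by rw [subtermAt_nil]; exact congrArg _ he.symm⟩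
          | func => cases he
        · exact h
      by_cases hzD : z ∈ D
      · obtain ⟨i, hi, hz⟩ := ih z hzD hz
        by_contra hn
        have : y ∈ U (j + 1) := hU ▸ Finset.mem_filter.2 ⟨hy, hn⟩
        exact (Finset.mem_filter.1 this).2 ⟨i + 1, Nat.succ_le_succ hi, hz.succ hp⟩
      · rw [hμ z hzD] at hp
        cases p with
        | cons => cases hp
        | nil =>
          rw [subtermAt_nil, Option.some.injEq, Term.var.injEq] at hp
          exact ih y hy (hp ▸ hz)
  obtain ⟨i, hi, h⟩ := key k y hy h
  exact ⟨i, hi.trans hj, h⟩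

/-- If `ℓ` matches a subterm of `x μ ^ k` for some `k`, then it does so for some small `k`. -/
theorem IsSubtermOfIter.exists_matches {ℓ : L.Term β} {x : α} {k K d : ℕ} {s : L.Term α}
    (h : IsSubtermOfIter μ x k s) (hm : Matches ℓ s)
    (hd : ∀ p u, subtermAt ℓ p = some u → p.length ≤ d) (hK : (d + 2) * D.card ≤ K) :
    ∃ j ≤ K + (D.card + 1), ∃ u, IsSubtermOfIter μ x j u ∧ Matches ℓ u := by
  classical
  -- Take the earliest subterm `s` that matches after any number `j` of further iterations. Leaving
  -- `j` free makes the minimal `i` small, and `j` may then be replaced by `K`.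
  have hex : ∃ i s j, IsSubtermOfIter μ x i s ∧ Matches ℓ (TermRewriting.substIter μ j s) :=
    ⟨k, s, 0, h, hm⟩
  obtain ⟨s, j, hs, hsm⟩ := Nat.find_spec hex
  have hmin : ∀ i < Nat.find hex, ∀ s j, IsSubtermOfIter μ x i s →
      ¬ Matches ℓ (TermRewriting.substIter μ j s) := fun i hi s j hs hm =>
    Nat.find_min hex hi ⟨s, j, hs, hm⟩
  generalize Nat.find hex = i at hs hmin
  refine ⟨K + i, ?_, _, hs.substIter K, matches_substIter_of_le hμ hsm hd hK⟩
  cases i with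
  | zero => omega
  | succ i =>
    obtain ⟨t, ht, rfl⟩ | ⟨y, p, hy, hp⟩ := hs.cases
    -- If `s = t μ`, then `t` occurs one step earlier. So `s` lies inside the image of a variable
    -- `y`, and `y` is reachable within `D.card` steps if it is in `D`.
    · exact (hmin i i.lt_succ_self t (j + 1) ht hsm).elim
    · by_cases hyD : y ∈ D
      · obtain ⟨i', hi', hy'⟩ := hy.exists_le_card hμ hyD
        by_contra! hlt
        exact hmin (i' + 1) (by omega) s j (hy'.succ hp) hsm
      · rw [hμ y hyD] at hp
        cases p with
        | cons => cases hp
        | nil =>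
          rw [subtermAt_nil, Option.some.injEq] at hp
          exact (hmin i i.lt_succ_self s j (hp ▸ hy) hsm).elim

end Reachability

/-! ### Bounding the exponents of violations -/

section Bound

variable {L : FirstOrder.Language.{u, v}}

/-- The pattern `π` forbids the redex position `p ^ m q` in the term `t(C,μ)^m μ ^ k`. -/
def Violates (C : Context L) (μ : FinSubst L) (p q : Position) (t : L.Term ℕ)
    (π : ForbiddenPattern L) (m k : ℕ) : Prop :=
  ∃ (o : Position) (u : L.Term ℕ), subtermAt (substIter μ.toFun k (ctxSubst C μ t m)) o = some u ∧
    Matches π.term u ∧ π.kind.Forbids (p.pow m ++ q) (o ++ π.pos)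

theorem Position.strictlyAbove_append_iff (p o o' : Position) :
    Position.StrictlyAbove (p ++ o) (p ++ o') ↔ Position.StrictlyAbove o o' := by
  simp [Position.StrictlyAbove, List.prefix_append_right_inj]

theorem PatternKind.forbids_append_iff (κ : PatternKind) (p o o' : Position) :
    κ.Forbids (p ++ o) (p ++ o') ↔ κ.Forbids o o' := by
  cases κ
  · simp [PatternKind.Forbids]
  · exact Position.strictlyAbove_append_iff _ _ _
  · exact Position.strictlyAbove_append_iff _ _ _

theorem PatternKind.Forbids.comparable {κ : PatternKind} {p o : Position} (h : κ.Forbids p o) :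
    p <+: o ∨ o <+: p := by
  cases κ
  · exact .inl (h ▸ List.prefix_rfl)
  · exact .inl h.1
  · exact .inr h.1

variable {C : Context L} {μ : FinSubst L} {p q : Position} {t : L.Term ℕ}
  {π : ForbiddenPattern L}

theorem subtermAt_substIter_ctxSubst_succ (hp : C.HoleAt p) (μ : FinSubst L) (t : L.Term ℕ)
    (m k : ℕ) (o : Position) : subtermAt (substIter μ.toFun k (ctxSubst C μ t (m + 1))) (p ++ o) =
      subtermAt (substIter μ.toFun (k + 1) (ctxSubst C μ t m)) o := by
  rw [ctxSubst, subtermAt_append_of_eq_some (subtermAt_substIter (hp.subtermAt_fill _) k)]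
  rfl

/-- Wrapping the term in one more context uses up one substitution and prefixes both the match and
the redex position by `p`. -/
theorem Violates.add (hp : C.HoleAt p) {m k : ℕ} (h : Violates C μ p q t π m k) :
    Violates C μ p q t π (m + k) 0 := by
  induction k generalizing m with
  | zero => exact h
  | succ k ih =>
    rw [← Nat.succ_add_eq_add_succ]
    refine ih ?_
    obtain ⟨o, u, ho, hm, hf⟩ := h
    refine ⟨p ++ o, u, ?_, hm, ?_⟩
    · rw [subtermAt_substIter_ctxSubst_succ hp, ho]
    · rwa [Position.pow_succ, List.append_assoc, List.append_assoc,
        PatternKind.forbids_append_iff]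

/-- A violation can be moved out of the enclosing contexts. -/
theorem Violates.exists_not_prefix (hp : C.HoleAt p) {m k : ℕ} (h : Violates C μ p q t π m k) :
    ∃ (m k : ℕ) (o : Position) (u : L.Term ℕ),
      subtermAt (substIter μ.toFun k (ctxSubst C μ t m)) o = some u ∧ Matches π.term u ∧
      π.kind.Forbids (p.pow m ++ q) (o ++ π.pos) ∧ (m = 0 ∨ ¬ p <+: o) := by
  induction m generalizing k with
  | zero =>
    obtain ⟨o, u, ho, hm, hf⟩ := h
    exact ⟨0, k, o, u, ho, hm, hf, .inl rfl⟩
  | succ m ih =>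
    obtain ⟨o, u, ho, hm, hf⟩ := h
    by_cases hpo : p <+: o
    · obtain ⟨o, rfl⟩ := hpo
      rw [subtermAt_substIter_ctxSubst_succ hp] at ho
      rw [Position.pow_succ, List.append_assoc, List.append_assoc,
        PatternKind.forbids_append_iff] at hf
      exact ih ⟨o, u, ho, hm, hf⟩
    · exact ⟨m + 1, k, o, u, ho, hm, hf, .inr hpo⟩

theorem FinSubst.matches_substIter {ℓ s : L.Term ℕ} {k d : ℕ}
    (h : Matches ℓ (substIter μ.toFun k s)) (hd : ∀ o u, subtermAt ℓ o = some u → o.length ≤ d) :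
    Matches ℓ (substIter μ.toFun ((d + 2) * μ.length) s) :=
  matches_substIter_of_le μ.toFun_eq_var h hd (Nat.mul_le_mul_left _ μ.card_domain_le)

/-- A match at a position of `t` is a matching problem for one fixed term. A match inside the image
of a variable of `t` lies strictly below the redex, so only kind `a` remains; its exact place is
then irrelevant, and reachability applies. -/
theorem Violates.exists_le_of_zero {k d : ℕ}
    (hq : ∃ (n : ℕ) (f : L.Functions n) (ts : Fin n → L.Term ℕ),
      subtermAt t q = some (Term.func f ts))
    (hd : ∀ o u, subtermAt π.term o = some u → o.length ≤ d) (h : Violates C μ p q t π 0 k) :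
    ∃ j ≤ (d + 2) * μ.length + (μ.length + 1), Violates C μ p q t π 0 j := by
  obtain ⟨o, u, ho, hm, hf⟩ := h
  change subtermAt (substIter μ.toFun k t) o = some u at ho
  change π.kind.Forbids q _ at hf
  rw [substIter_eq_subst] at ho
  obtain ⟨s, hs, rfl⟩ | ⟨o₁, o₂, x, rfl, h₁, h₂⟩ := subtermAt_subst_cases ho
  · rw [← substIter_eq_subst] at hm
    exact ⟨_, Nat.le_add_right _ _, o, _, subtermAt_substIter hs _,
      FinSubst.matches_substIter hm hd, hf⟩
  · have hne : ¬ o₁ <+: q := by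
      rintro ⟨r, rfl⟩
      obtain ⟨n, f, ts, hq⟩ := hq
      rw [subtermAt_append_of_eq_some h₁] at hq
      cases r <;> simp at hq
    have hlt : q <+: o₁ := by
      rw [List.append_assoc] at hf
      obtain hc | hc := hf.comparable
      · exact (List.prefix_or_prefix_of_prefix hc (List.prefix_append _ _)).resolve_right hne
      · exact (hne ((List.prefix_append _ _).trans hc)).elim
    have hlt' : ∀ r, q.StrictlyAbove (o₁ ++ r) := fun r =>
      ⟨hlt.trans (List.prefix_append _ _), fun he => hne (he ▸ List.prefix_append _ _)⟩
    obtain ⟨j, hj, u', ⟨o', ho'⟩, hm'⟩ := IsSubtermOfIter.exists_matches μ.toFun_eq_var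
      (ℓ := π.term) ⟨o₂, h₂⟩ hm hd (Nat.mul_le_mul_left _ μ.card_domain_le)
    refine ⟨j, hj.trans (Nat.add_le_add_left (Nat.succ_le_succ μ.card_domain_le) _), o₁ ++ o', u',
      ?_, hm', ?_⟩
    · change subtermAt (substIter μ.toFun j t) _ = _
      rw [subtermAt_append_of_eq_some (subtermAt_substIter h₁ j), ho']
    · change π.kind.Forbids q _
      rw [List.append_assoc] at hf ⊢
      cases hκ : π.kind <;> rw [hκ] at hf
      · exact (hne (hf ▸ List.prefix_append _ _)).elim
      · exact hlt' _
      · exact (hne ((List.prefix_append _ _).trans hf.1)).elim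

/-- If `ℓ` matches a subterm on the path of contexts, then it does so for one context less,
provided that there are many of them. -/
theorem matches_ctxSubst_pred (hp : C.HoleAt p) {ℓ a a' : L.Term ℕ} {o : Position} {d J N K n : ℕ}
    (ho : o.length < p.length) (hd : ∀ w u, subtermAt ℓ w = some u → w.length ≤ d)
    (hJ : p.length + d ≤ J)
    (hN : ∀ w u, subtermAt (substIter μ.toFun K (ctxSubst C μ t J)) w = some u → w.length ≤ N)
    (hn : J + N + 1 ≤ n) (ha : subtermAt (substIter μ.toFun K (ctxSubst C μ t n)) o = some a)
    (ha' : subtermAt (substIter μ.toFun K (ctxSubst C μ t (n + 1))) o = some a')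
    (hm : Matches ℓ a') : Matches ℓ a := by
  -- The hole is too deep to be seen by the pattern. Here `p` is nonempty because `o` is shorter.
  have hpow : ∀ k w u, J ≤ k → subtermAt ℓ w = some u → ¬ p.pow k <+: o ++ w := by
    intro k w u hk hw hpre
    have h1 := hpre.length_le
    have h2 := hd w u hw
    rw [Position.length_pow, List.length_append] at h1
    nlinarith
  have hdiff : ∀ (s t : L.Term ℕ) (n : ℕ), DifferOnlyAt (p.pow n)
      (substIter μ.toFun K (ctxSubst C μ s n)) (substIter μ.toFun K (ctxSubst C μ t n)) := by
    intro s t n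
    rw [substIter_eq_subst, substIter_eq_subst (t := ctxSubst C μ t n)]
    exact (differOnlyAt_ctxSubst hp μ s t n).subst _
  -- A tower of height `n + 1` over `t` is one of height `n` over `t(C,μ)`, so the two towers differ
  -- only at `p^n`.
  have hX := hdiff (ctxSubst C μ t 1) t n
  rw [← ctxSubst_add] at hX
  -- If `w` lies on the path to the hole and `w' ≠ w` carries the same variable, then `w'` is off
  -- the path. The subterm there already occurs in the tower of height `J` and has depth at most
  -- `N`, whereas the one at `w` still contains the position `p^n`.
  have hoff : ∀ w w' x, subtermAt ℓ w = some (Term.var x) → subtermAt ℓ w' = some (Term.var x) →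
      subtermAt a' w = subtermAt a' w' → o ++ w <+: p.pow n → w = w' := by
    intro w w' x hw hw' he hpre
    by_contra hne
    have hnpre : ¬ o ++ w' <+: p.pow n := by
      intro hpre'
      have hvar : ∀ {v v' : Position}, subtermAt ℓ v = some (Term.var x) →
          subtermAt ℓ v' = some (Term.var x) → v <+: v' → v = v' := by
        rintro v _ hv hv' ⟨r, rfl⟩
        rw [subtermAt_append_of_eq_some hv] at hv'
        cases r with
        | nil => simp
        | cons => cases hv'
      obtain h | h := List.prefix_or_prefix_of_prefix hpre hpre'
      · exact hne (hvar hw hw' ((List.prefix_append_right_inj o).1 h))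
      · exact hne (hvar hw' hw ((List.prefix_append_right_inj o).1 h)).symm
    have hJn : ctxSubst C μ t (n + 1) = ctxSubst C μ (ctxSubst C μ t (n + 1 - J)) J := by
      rw [← ctxSubst_add]; congr 1; omega
    have hsame : subtermAt a' w' = subtermAt (substIter μ.toFun K (ctxSubst C μ t J)) (o ++ w') := by
      rw [← subtermAt_append_of_eq_some ha', hJn]
      exact (hdiff _ t J).subtermAt_eq (hpow J w' _ le_rfl hw') fun h =>
        hnpre (h.trans (p.pow_prefix_pow (by omega)))
    obtain ⟨r, hr⟩ := hpre
    have hpos : subtermAt (substIter μ.toFun K (ctxSubst C μ t (n + 1))) (p.pow n) =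
        some (substIter μ.toFun K (substIter μ.toFun n (ctxSubst C μ t 1))) := by
      rw [ctxSubst_add]
      exact subtermAt_substIter (subtermAt_ctxSubst_pow hp μ _ n) K
    rw [← hr, subtermAt_append, subtermAt_append_of_eq_some ha', he, hsame, ← subtermAt_append]
      at hpos
    have h1 := hN _ _ hpos
    have h2 := hd w _ hw
    have h3 := congrArg List.length hr
    simp only [List.length_append, Position.length_pow] at h1 h3
    nlinarith
  rw [matches_iff] at hm ⊢
  constructor
  · intro w g hw
    obtain ⟨u, hu, -⟩ := Option.map_eq_some_iff.1 hw
    rw [← rootAt_append_of_eq_some ha, ← hX.rootAt_eq (hpow n w u (by omega) hu),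
      rootAt_append_of_eq_some ha']
    exact hm.1 w g hw
  · intro w w' x hw hw'
    have he := hm.2 w w' x hw hw'
    -- Two distinct occurrences of a variable are both off the path, where the two towers have the
    -- same subterms.
    by_cases h : o ++ w <+: p.pow n
    · rw [hoff w w' x hw hw' he h]
    by_cases h' : o ++ w' <+: p.pow n
    · rw [hoff w' w x hw' hw he.symm h']
    rw [← subtermAt_append_of_eq_some ha, ← subtermAt_append_of_eq_some ha,
      ← hX.subtermAt_eq (hpow n w _ (by omega) hw) h,
      ← hX.subtermAt_eq (hpow n w' _ (by omega) hw') h',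
      subtermAt_append_of_eq_some ha', subtermAt_append_of_eq_some ha', he]

theorem exists_subtermAt_ctxSubst (hp : C.HoleAt p) {o : Position} (ho : o <+: p)
    {m : ℕ} (hm : m ≠ 0) : ∃ s, subtermAt (ctxSubst C μ t m) o = some s := by
  obtain ⟨m, rfl⟩ := Nat.exists_eq_succ_of_ne_zero hm
  obtain ⟨r, rfl⟩ := ho
  obtain ⟨s, hs, -⟩ := exists_subtermAt_of_append (hp.subtermAt_fill ((ctxSubst C μ t m).subst μ.toFun))
  exact ⟨s, hs⟩

/-- A violation exists for small exponents if it exists at all. -/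
theorem Violates.exists_le (hp : C.HoleAt p)
    (hq : ∃ (n : ℕ) (f : L.Functions n) (ts : Fin n → L.Term ℕ),
      subtermAt t q = some (Term.func f ts))
    {m k d N J : ℕ} (hd : ∀ o u, subtermAt π.term o = some u → o.length ≤ d)
    (hJ : p.length + d ≤ J)
    (hN : ∀ w u, subtermAt (substIter μ.toFun ((d + 2) * μ.length) (ctxSubst C μ t J)) w = some u →
      w.length ≤ N)
    (h : Violates C μ p q t π m k) :
    ∃ n ≤ J + N + 1 + π.pos.length + ((d + 2) * μ.length + (μ.length + 1)),
      Violates C μ p q t π n 0 := by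
  obtain ⟨m, k, o, u, ho, hm, hf, hmo⟩ := h.exists_not_prefix hp
  suffices ∃ m' ≤ J + N + 1 + π.pos.length, ∃ k' ≤ (d + 2) * μ.length + (μ.length + 1),
      Violates C μ p q t π m' k' by
    obtain ⟨m', hm', k', hk', h⟩ := this
    exact ⟨m' + k', Nat.add_le_add hm' hk', h.add hp⟩
  obtain rfl | hm0 := Nat.eq_zero_or_pos m
  · obtain ⟨j, hj, h⟩ := Violates.exists_le_of_zero hq hd ⟨o, u, ho, hm, hf⟩
    exact ⟨0, Nat.zero_le _, j, hj, h⟩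
  have hnpo := hmo.resolve_left hm0.ne'
  have hpm : p <+: p.pow m ++ q := by
    obtain ⟨m, rfl⟩ := Nat.exists_eq_succ_of_ne_zero hm0.ne'
    rw [Position.pow_succ, List.append_assoc]
    exact List.prefix_append _ _
  -- The pattern position is comparable with the redex position, which starts with `p`; so `o` is
  -- comparable with `p`.
  have hop : o <+: p := by
    obtain hc | hc := hf.comparable
    · exact (List.prefix_or_prefix_of_prefix (hpm.trans hc) (List.prefix_append _ _)).resolve_left
        hnpo
    · exact (List.prefix_or_prefix_of_prefix hpm ((List.prefix_append _ _).trans hc)).resolve_left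
        hnpo
  have hlt : o.length < p.length :=
    lt_of_not_ge fun hle => hnpo (hop.eq_of_length_le hle ▸ List.prefix_rfl)
  obtain ⟨s, hs⟩ := exists_subtermAt_ctxSubst (t := t) (μ := μ) hp hop hm0.ne'
  rw [subtermAt_substIter hs, Option.some.injEq] at ho
  subst ho
  have hK := FinSubst.matches_substIter hm hd
  by_cases hle : m ≤ J + N + 1 + π.pos.length
  · exact ⟨m, hle, _, Nat.le_add_right _ _, o, _, subtermAt_substIter hs _, hK, hf⟩
  push Not at hle
  -- Contexts are removed one at a time while the exponent of `μ` stays fixed.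
  have hdesc : ∀ i, ∀ s, subtermAt (ctxSubst C μ t (J + N + 1 + π.pos.length + i)) o = some s →
      Matches π.term (substIter μ.toFun ((d + 2) * μ.length) s) →
      ∃ s, subtermAt (ctxSubst C μ t (J + N + 1 + π.pos.length)) o = some s ∧
        Matches π.term (substIter μ.toFun ((d + 2) * μ.length) s) := by
    intro i
    induction i with
    | zero => exact fun s hs hm => ⟨s, hs, hm⟩
    | succ i ih =>
      intro s hs hm
      obtain ⟨s', hs'⟩ := exists_subtermAt_ctxSubst (t := t) (μ := μ) hp hop
        (m := J + N + 1 + π.pos.length + i) (by omega)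
      exact ih s' hs' (matches_ctxSubst_pred hp hlt hd hJ hN (by omega)
        (subtermAt_substIter hs' _) (subtermAt_substIter hs _) hm)
  obtain ⟨i, rfl⟩ := Nat.exists_eq_add_of_le hle.le
  obtain ⟨s', hs', hm'⟩ := hdesc i s hs hK
  refine ⟨_, le_rfl, _, Nat.le_add_right _ _, o, _, subtermAt_substIter hs' _, hm', ?_⟩
  -- The summand `π.pos.length` makes the shortened redex position still longer than the pattern
  -- position. This excludes kinds `h` and `a`, and preserves the prefix relation for kind `b`.
  have hlen : (o ++ π.pos).length < (p.pow (J + N + 1 + π.pos.length)).length := by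
    rw [List.length_append, Position.length_pow]
    nlinarith
  rw [Position.pow_add, List.append_assoc] at hf
  have hnot : ∀ r, ¬ p.pow (J + N + 1 + π.pos.length) ++ r <+: o ++ π.pos := fun r h => by
    have := h.length_le
    rw [List.length_append] at this
    omega
  cases hκ : π.kind <;> rw [hκ] at hf
  · exact ((hnot (p.pow i ++ q)) ⟨[], (List.append_nil _).trans hf⟩).elim
  · exact (hnot _ hf.1).elim
  · refine ⟨?_, fun he => hnot q (he ▸ List.prefix_rfl)⟩
    exact (List.prefix_of_prefix_length_le hf.1 (List.prefix_append _ _) hlen.le).trans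
      (List.prefix_append _ _)

end Bound

/-! ### The decision procedure on codes -/

section Codes

variable {α β : Type}

/-- The arity of a symbol, where variables have arity `0`. -/
def symbolArity (s : α ⊕ ℕ × ℕ) : ℕ := Sum.elim (fun _ => 0) Prod.fst s

/-- One step of `skipTerms`: the number of terms still to be skipped, and the symbols kept. -/
def skipStep (st : ℕ × TermCode α) (s : α ⊕ ℕ × ℕ) : ℕ × TermCode α :=
  if st.1 = 0 then (0, st.2 ++ [s]) else (st.1 - 1 + symbolArity s, st.2)

/-- Drop the codes of `k` terms. -/
def skipTerms (k : ℕ) (c : TermCode α) : TermCode α := (c.foldl skipStep (k, [])).2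

theorem foldl_skipStep_zero (c r : TermCode α) : (c.foldl skipStep (0, r)).2 = r ++ c := by
  induction c generalizing r with
  | nil => simp
  | cons s c ih => simp [skipStep, ih]

theorem skipTerms_zero (c : TermCode α) : skipTerms 0 c = c :=
  (foldl_skipStep_zero c []).trans (List.nil_append c)

theorem skipTerms_succ_cons (k : ℕ) (s : α ⊕ ℕ × ℕ) (c : TermCode α) :
    skipTerms (k + 1) (s :: c) = skipTerms (k + symbolArity s) c := by
  simp [skipTerms, skipStep]

/-- The code of the first term. -/
def firstTerm (c : TermCode α) : TermCode α := c.take (c.length - (skipTerms 1 c).length)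

/-- The code of the `i`-th argument of a term. -/
def childCode (c : TermCode α) (i : ℕ) : Option (TermCode α) :=
  c.head?.bind fun s => if i < symbolArity s then some (firstTerm (skipTerms i c.tail)) else none

theorem childCode_inr_cons (g : ℕ × ℕ) (c : TermCode α) (i : ℕ) :
    childCode (.inr g :: c) i = if i < g.1 then some (firstTerm (skipTerms i c)) else none := rfl

/-- The code of the subterm at a position. -/
def subCode (c : TermCode α) (p : Position) : Option (TermCode α) :=
  p.foldl (fun o i => o.bind fun d => childCode d i) (some c)

/-- The code of the symbol at a position. -/
def headCode (c : TermCode α) (p : Position) : Option (α ⊕ ℕ × ℕ) :=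
  (subCode c p).bind List.head?

/-- The code of an instance of a term. -/
def substCode (f : α → TermCode β) (c : TermCode α) : TermCode β :=
  c.flatMap (Sum.elim f fun g => [.inr g])

/-- The positions of length at most `k` with entries below `N`. -/
def boundedPositions (N k : ℕ) : List Position :=
  (fun W => [] :: (List.range N).flatMap fun i => W.map fun p => i :: p)^[k] [[]]

theorem mem_boundedPositions {N k : ℕ} {p : Position} (hk : p.length ≤ k) (hN : ∀ i ∈ p, i < N) :
    p ∈ boundedPositions N k := by
  induction k generalizing p with
  | zero => simp [boundedPositions, List.length_eq_zero_iff.1 (Nat.le_zero.1 hk)]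
  | succ k ih =>
    rw [boundedPositions, Function.iterate_succ_apply', ← boundedPositions]
    cases p with
    | nil => exact List.mem_cons_self
    | cons i p =>
      refine List.mem_cons_of_mem _ (List.mem_flatMap.2 ⟨i, ?_, List.mem_map_of_mem ?_⟩)
      · exact List.mem_range.2 (hN i List.mem_cons_self)
      · exact ih (Nat.le_of_succ_le_succ hk) fun j hj => hN j (List.mem_cons_of_mem _ hj)

/-- A list that contains all positions of a term with code `c`. -/
def positionsCode (c : TermCode α) : List Position := boundedPositions c.length c.length

section TermCode

variable {L : FirstOrder.Language.{u, v}} (e : (Σ n, L.Functions n) ↪ ℕ)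

theorem termCode_var (x : α) : termCode e (Term.var x : L.Term α) = [.inl x] := rfl

theorem termCode_func {n : ℕ} (f : L.Functions n) (ts : Fin n → L.Term α) :
    termCode e (Term.func f ts) =
      .inr (n, e ⟨n, f⟩) :: (List.finRange n).flatMap fun i => termCode e (ts i) := by
  simp [termCode, Term.listEncode, List.map_flatMap]

/-- The code of a symbol. -/
def symbolCode (s : α ⊕ (Σ n, L.Functions n)) : α ⊕ ℕ × ℕ := Sum.map id (fun f => (f.1, e f)) s

theorem symbolCode_injective : Function.Injective (symbolCode (α := α) e) :=
  Sum.map_injective.2 ⟨Function.injective_id, fun _ _ h => e.injective (Prod.mk.inj h).2⟩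

theorem termCode_injective : Function.Injective (termCode e : L.Term α → TermCode α) :=
  (List.map_injective_iff.2 (symbolCode_injective e)).comp Term.listEncode_injective

theorem head?_termCode (t : L.Term α) : (termCode e t).head? = some (symbolCode e (root t)) := by
  cases t <;> rfl

theorem termCode_subst (t : L.Term α) (σ : α → L.Term β) :
    termCode e (t.subst σ) = substCode (fun x => termCode e (σ x)) (termCode e t) := by
  induction t with
  | var x => simp [termCode_var, substCode, Term.subst]
  | func f ts ih =>
    simp only [Term.subst, termCode_func, substCode, List.flatMap_cons, Sum.elim_inr,
      List.singleton_append, List.flatMap_assoc, List.cons.injEq, true_and]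
    exact congrArg (List.flatMap · _) (funext ih)

theorem skipTerms_flatMap {ι : Type*} {f : ι → TermCode α}
    (hf : ∀ i k r, skipTerms (k + 1) (f i ++ r) = skipTerms k r) (l : List ι) (k : ℕ)
    (r : TermCode α) : skipTerms (k + l.length) (l.flatMap f ++ r) = skipTerms k r := by
  induction l with
  | nil => rfl
  | cons i l ih => rw [List.length_cons, ← add_assoc, List.flatMap_cons, List.append_assoc, hf, ih]

/-- Prefix notation is self-delimiting: a symbol settles one pending term and opens as many as its
arity, so a counter finds the end of each term. -/
theorem skipTerms_termCode (t : L.Term α) (k : ℕ) (r : TermCode α) :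
    skipTerms (k + 1) (termCode e t ++ r) = skipTerms k r := by
  induction t generalizing k r with
  | var x => exact skipTerms_succ_cons k _ r
  | @func n f ts ih =>
    rw [termCode_func, List.cons_append, skipTerms_succ_cons]
    have := skipTerms_flatMap (f := fun i => termCode e (ts i)) ih (List.finRange n) k r
    rwa [List.length_finRange] at this

theorem firstTerm_termCode_append (t : L.Term α) (r : TermCode α) :
    firstTerm (termCode e t ++ r) = termCode e t := by
  have : skipTerms 1 (termCode e t ++ r) = r :=
    (skipTerms_termCode e t 0 r).trans (skipTerms_zero r)
  simp [firstTerm, this]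

theorem finRange_eq_append {n i : ℕ} (h : i < n) :
    List.finRange n = (List.finRange n).take i ++ ⟨i, h⟩ :: (List.finRange n).drop (i + 1) := by
  conv_lhs => rw [← List.take_append_drop i (List.finRange n)]
  rw [List.drop_eq_getElem_cons (by simpa using h), List.getElem_finRange]
  rfl

theorem childCode_var (x : α) (i : ℕ) : childCode (termCode e (Term.var x : L.Term α)) i = none := by
  simp [childCode, termCode_var, symbolArity]

theorem childCode_func {n : ℕ} (f : L.Functions n) (ts : Fin n → L.Term α) (i : ℕ) :
    childCode (termCode e (Term.func f ts)) i =
      if h : i < n then some (termCode e (ts ⟨i, h⟩)) else none := by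
  rw [termCode_func, childCode_inr_cons]
  by_cases h : i < n
  · rw [if_pos h, dif_pos h, finRange_eq_append h, List.flatMap_append, List.flatMap_cons]
    have := skipTerms_flatMap (skipTerms_termCode e <| ts ·) ((List.finRange n).take i) 0
      (termCode e (ts ⟨i, h⟩) ++
        List.flatMap (fun i => termCode e (ts i)) ((List.finRange n).drop (i + 1)))
    rw [List.length_take, List.length_finRange, min_eq_left h.le, zero_add, skipTerms_zero] at this
    rw [this, firstTerm_termCode_append]
  · rw [if_neg h, dif_neg h]

theorem subCode_cons (c : TermCode α) (i : ℕ) (p : Position) :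
    subCode c (i :: p) = (childCode c i).bind fun d => subCode d p := by
  have hnone : ∀ p : Position, p.foldl (fun (o : Option (TermCode α)) i =>
      o.bind fun d => childCode d i) none = none := by
    intro p
    induction p with
    | nil => rfl
    | cons i p ih => exact ih
  rw [subCode, List.foldl_cons, Option.bind_some]
  cases childCode c i with
  | none => exact hnone p
  | some d => rfl

theorem subCode_termCode (t : L.Term α) (p : Position) :
    subCode (termCode e t) p = (subtermAt t p).map (termCode e) := by
  induction p generalizing t with
  | nil => simp [subCode]
  | cons i p ih =>
    rw [subCode_cons]
    cases t with
    | var x => rw [childCode_var]; rfl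
    | func f ts =>
      rw [childCode_func, subtermAt_func_cons]
      split_ifs
      · exact ih _
      · rfl

theorem headCode_termCode (t : L.Term α) (p : Position) :
    headCode (termCode e t) p = (rootAt t p).map (symbolCode e) := by
  rw [headCode, subCode_termCode, rootAt]
  cases subtermAt t p with
  | none => rfl
  | some u => exact head?_termCode e u

theorem length_termCode_pos (t : L.Term α) : 0 < (termCode e t).length := by
  cases t with
  | var => exact Nat.one_pos
  | func => rw [termCode_func]; exact Nat.succ_pos _

theorem length_termCode_child {n : ℕ} (f : L.Functions n) (ts : Fin n → L.Term α) (i : Fin n) :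
    i + (termCode e (ts i)).length < (termCode e (Term.func f ts)).length := by
  have hlen : ∀ l : List (Fin n), l.length ≤ (l.flatMap fun i => termCode e (ts i)).length := by
    intro l
    induction l with
    | nil => simp
    | cons j l ih =>
      have := length_termCode_pos e (ts j)
      simp only [List.length_cons, List.flatMap_cons, List.length_append]
      omega
  have h := hlen ((List.finRange n).take i)
  rw [List.length_take, List.length_finRange, min_eq_left i.2.le] at h
  rw [termCode_func, finRange_eq_append i.2, List.flatMap_append, List.flatMap_cons,
    List.length_cons, List.length_append, List.length_append]
  simp only [Fin.eta]
  omega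

/-- The length of a code bounds both the depth and the argument indices. This makes the search over
positions finite and provides the depth bounds `d` and `N` in `violationBound`. -/
theorem bounds_of_subtermAt {t u : L.Term α} {p : Position} (h : subtermAt t p = some u) :
    p.length ≤ (termCode e t).length ∧ ∀ i ∈ p, i < (termCode e t).length := by
  induction p generalizing t with
  | nil => simp
  | cons i p ih =>
    obtain ⟨n, f, ts, hi, rfl, h'⟩ := exists_func_of_subtermAt_cons h
    obtain ⟨h1, h2⟩ := ih h'
    have h3 := length_termCode_child e f ts ⟨i, hi⟩
    refine ⟨by simp only [List.length_cons]; omega, fun j hj => ?_⟩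
    obtain rfl | hj := List.mem_cons.1 hj
    · simp only at h3; omega
    · have := h2 j hj; omega

theorem mem_positionsCode {t u : L.Term α} {p : Position} (h : subtermAt t p = some u) :
    p ∈ positionsCode (termCode e t) :=
  mem_boundedPositions (bounds_of_subtermAt e h).1 (bounds_of_subtermAt e h).2

end TermCode

/-- Matching, for codes of terms. -/
def MatchesCode (l c : TermCode ℕ) : Prop :=
  ∀ p ∈ positionsCode l, ∀ q ∈ positionsCode l,
    (headCode l p = none ∨ (headCode l p).any Sum.isLeft = true ∨ headCode c p = headCode l p) ∧
    ((headCode l p).any Sum.isLeft = false ∨ headCode l q ≠ headCode l p ∨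
      subCode c p = subCode c q)

theorem matchesCode_termCode {L : FirstOrder.Language.{u, v}} (e : (Σ n, L.Functions n) ↪ ℕ)
    (ℓ t : L.Term ℕ) : MatchesCode (termCode e ℓ) (termCode e t) ↔ Matches ℓ t := by
  have hvar : ∀ {p x}, subtermAt ℓ p = some (Term.var x) →
      headCode (termCode e ℓ) p = some (.inl x) := by
    intro p x h
    rw [headCode_termCode, rootAt_eq_inl.2 h]
    rfl
  rw [matches_iff]
  constructor
  · intro h
    constructor
    · intro p g hg
      obtain ⟨u, hu, -⟩ := Option.map_eq_some_iff.1 hg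
      have hp := mem_positionsCode e hu
      have := (h p hp p hp).1
      rw [headCode_termCode, headCode_termCode, hg] at this
      obtain h | h | h := this
      · cases h
      · simp [symbolCode] at h
      · obtain ⟨s, hs, hs'⟩ := Option.map_eq_some_iff.1 h
        rw [hs, symbolCode_injective e hs']
    · intro p q x hp hq
      have := (h p (mem_positionsCode e hp) q (mem_positionsCode e hq)).2
      rw [hvar hp, hvar hq, subCode_termCode, subCode_termCode] at this
      simp only [Option.any_some, Sum.isLeft_inl, Bool.true_eq_false, ne_eq, not_true_eq_false,
        false_or] at this
      exact Option.map_injective (termCode_injective e) this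
  · rintro ⟨h1, h2⟩ p - q -
    constructor
    · rw [headCode_termCode, headCode_termCode]
      cases hr : rootAt ℓ p with
      | none => exact .inl rfl
      | some s =>
        cases s with
        | inl x => exact .inr (.inl rfl)
        | inr g => rw [h1 p g hr]; exact .inr (.inr rfl)
    · rw [headCode_termCode, headCode_termCode]
      cases hr : rootAt ℓ p with
      | none => exact .inl rfl
      | some s =>
        cases s with
        | inr g => exact .inl rfl
        | inl x =>
          by_cases hq : rootAt ℓ q = some (.inl x)
          · rw [subCode_termCode, subCode_termCode,
              h2 p q x (rootAt_eq_inl.1 hr) (rootAt_eq_inl.1 hq)]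
            exact .inr (.inr rfl)
          · exact .inr (.inl fun h => hq (Option.map_injective (symbolCode_injective e) h))

/-- The code of `t μ`. -/
def applyCode (m : List (ℕ × TermCode ℕ)) (c : TermCode ℕ) : TermCode ℕ :=
  substCode (fun x => (m.lookup x).getD [.inl x]) c

/-- The code of `C[t]`. -/
def fillCode (C : TermCode (Option ℕ)) (c : TermCode ℕ) : TermCode ℕ :=
  substCode (fun x => x.elim c fun y => [.inl y]) C

/-- The code of `t(C,μ)^n`. -/
def ctxSubstCode (C : TermCode (Option ℕ)) (m : List (ℕ × TermCode ℕ)) (c : TermCode ℕ) (n : ℕ) :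
    TermCode ℕ :=
  (fun c => fillCode C (applyCode m c))^[n] c

/-- The relation `PatternKind.Forbids`, for codes. -/
def ForbidsCode (κ : ℕ) (p o : Position) : Prop :=
  (κ = 0 ∧ p = o) ∨ (κ = 1 ∧ o.take p.length = p ∧ p ≠ o) ∨ (κ = 2 ∧ p.take o.length = o ∧ o ≠ p)

theorem forbidsCode_code (κ : PatternKind) (p o : Position) :
    ForbidsCode κ.code p o ↔ κ.Forbids p o := by
  cases κ <;> simp [ForbidsCode, PatternKind.code, PatternKind.Forbids, Position.StrictlyAbove,
    List.prefix_iff_eq_take, eq_comm]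

/-- The code of a forbidden pattern. -/
abbrev PatternCode : Type := TermCode ℕ × Position × ℕ

/-- The code of a loop without its terms and positions: the context, the substitution, and the
position of the hole. -/
abbrev FrameCode : Type := TermCode (Option ℕ) × List (ℕ × TermCode ℕ) × Position

/-- The relation `Violates` for codes. -/
def ViolatesCode (F : FrameCode) (q : Position) (c : TermCode ℕ) (π : PatternCode) (n : ℕ) : Prop :=
  ∃ o ∈ positionsCode (ctxSubstCode F.1 F.2.1 c n), subCode (ctxSubstCode F.1 F.2.1 c n) o ≠ none ∧
    MatchesCode π.1 ((subCode (ctxSubstCode F.1 F.2.1 c n) o).getD []) ∧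
    ForbidsCode π.2.2 ((List.replicate n F.2.2).flatten ++ q) (o ++ π.2.1)

/-- A number of exponents that suffices for the search for violations. -/
def violationBound (F : FrameCode) (c : TermCode ℕ) (π : PatternCode) : ℕ :=
  (F.2.2.length + π.1.length) +
    ((applyCode F.2.1)^[(π.1.length + 2) * F.2.1.length]
      (ctxSubstCode F.1 F.2.1 c (F.2.2.length + π.1.length))).length + 1 +
    π.2.1.length + ((π.1.length + 2) * F.2.1.length + (F.2.1.length + 1))

/-- The decision procedure. -/
def NoViolationCode (x : InputCode) : Prop :=
  ∀ i ∈ List.range x.2.1.2.1.length, ∀ π ∈ x.2.2,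
    ∀ n ∈ List.range (violationBound x.2.1.2.2 (x.2.1.1.getD i []) π + 1),
      ¬ ViolatesCode x.2.1.2.2 (x.2.1.2.1.getD i []) (x.2.1.1.getD i []) π n

end Codes

/-! ### Correctness of the decision procedure -/

section Correctness

variable {L : FirstOrder.Language.{u, v}} (e : (Σ n, L.Functions n) ↪ ℕ)

/-- The code of a substitution. -/
def finSubstCode (μ : FinSubst L) : List (ℕ × TermCode ℕ) := μ.map fun b => (b.1, termCode e b.2)

theorem termCode_toFun (μ : FinSubst L) (x : ℕ) :
    termCode e (μ.toFun x) = ((finSubstCode e μ).lookup x).getD [.inl x] := by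
  have : (finSubstCode e μ).lookup x = (List.lookup x μ).map (termCode e) := by
    induction μ with
    | nil => rfl
    | cons b μ ih =>
      rw [finSubstCode, List.map_cons, ← finSubstCode, List.lookup_cons, List.lookup_cons, ih]
      split <;> rfl
  rw [this, FinSubst.toFun]
  cases List.lookup x μ <;> rfl

theorem termCode_subst_toFun (μ : FinSubst L) (t : L.Term ℕ) :
    termCode e (t.subst μ.toFun) = applyCode (finSubstCode e μ) (termCode e t) := by
  rw [termCode_subst, applyCode]
  exact congrArg (substCode · _) (funext fun x => termCode_toFun e μ x)

theorem termCode_substIter (μ : FinSubst L) (t : L.Term ℕ) (k : ℕ) :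
    termCode e (substIter μ.toFun k t) = (applyCode (finSubstCode e μ))^[k] (termCode e t) := by
  induction k with
  | zero => rfl
  | succ k ih =>
    rw [substIter_succ', termCode_subst_toFun, ih, Function.iterate_succ_apply']

theorem termCode_fill (C : Context L) (t : L.Term ℕ) :
    termCode e (C.fill t) = fillCode (termCode e C.toTerm) (termCode e t) := by
  rw [Context.fill, termCode_subst, fillCode]
  refine congrArg (substCode · _) (funext fun x => ?_)
  cases x <;> rfl

theorem termCode_ctxSubst (C : Context L) (μ : FinSubst L) (t : L.Term ℕ) (n : ℕ) :
    termCode e (ctxSubst C μ t n) =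
      ctxSubstCode (termCode e C.toTerm) (finSubstCode e μ) (termCode e t) n := by
  induction n with
  | zero => rfl
  | succ n ih =>
    rw [ctxSubst, termCode_fill, termCode_subst_toFun, ih, ctxSubstCode, ctxSubstCode,
      Function.iterate_succ_apply']

/-- The code of a context, a substitution, and the position of the hole. -/
def frameCode (C : Context L) (μ : FinSubst L) (p : Position) : FrameCode :=
  (termCode e C.toTerm, finSubstCode e μ, p)

/-- The code of a forbidden pattern. -/
def patternCode (π : ForbiddenPattern L) : PatternCode := (termCode e π.term, π.pos, π.kind.code)

theorem violatesCode_iff (C : Context L) (μ : FinSubst L) (p q : Position) (t : L.Term ℕ)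
    (π : ForbiddenPattern L) (n : ℕ) :
    ViolatesCode (frameCode e C μ p) q (termCode e t) (patternCode e π) n ↔
      Violates C μ p q t π n 0 := by
  simp only [ViolatesCode, frameCode, patternCode, ← termCode_ctxSubst, subCode_termCode,
    forbidsCode_code]
  constructor
  · rintro ⟨o, -, hne, hm, hf⟩
    cases hu : subtermAt (ctxSubst C μ t n) o with
    | none => simp [hu] at hne
    | some u =>
      rw [hu, Option.map_some, Option.getD_some, matchesCode_termCode] at hm
      exact ⟨o, u, hu, hm, hf⟩
  · rintro ⟨o, u, hu, hm, hf⟩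
    rw [substIter_zero] at hu
    refine ⟨o, mem_positionsCode e hu, by simp [hu], ?_, hf⟩
    rwa [hu, Option.map_some, Option.getD_some, matchesCode_termCode]

theorem exists_violates_iff {C : Context L} {μ : FinSubst L} {p q : Position} {t : L.Term ℕ}
    {π : ForbiddenPattern L} (hp : C.HoleAt p)
    (hq : ∃ (n : ℕ) (f : L.Functions n) (ts : Fin n → L.Term ℕ),
      subtermAt t q = some (Term.func f ts)) :
    (∃ n, Violates C μ p q t π n 0) ↔
      ∃ n ≤ violationBound (frameCode e C μ p) (termCode e t) (patternCode e π),
        Violates C μ p q t π n 0 := by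
  refine ⟨fun ⟨n, h⟩ => ?_, fun ⟨n, _, h⟩ => ⟨n, h⟩⟩
  have hlen : (finSubstCode e μ).length = μ.length := List.length_map _
  -- Code lengths serve as depths: `d` for the pattern, `J = p.length + d`, and `N` for the tower of
  -- height `J`.
  have := h.exists_le hp hq (d := (termCode e π.term).length)
    (fun o u ho => (bounds_of_subtermAt e ho).1) le_rfl
    fun w u hw => (bounds_of_subtermAt e hw).1
  rw [termCode_substIter, termCode_ctxSubst] at this
  simpa only [violationBound, frameCode, patternCode, hlen] using this

theorem Loop.isStrategyLoop_patternStep_iff {R : TRS L} (ℓ : Loop R)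
    (Pat : List (ForbiddenPattern L)) :
    ℓ.IsStrategyLoop (PatternStep R {π | π ∈ Pat}) ↔
      ∀ i : Fin ℓ.m, ∀ π ∈ Pat, ¬ ∃ n, Violates ℓ.C ℓ.μ ℓ.p (ℓ.q i) (ℓ.t i.castSucc) π n 0 := by
  constructor
  · rintro h i π hπ ⟨n, o, u, ho, ⟨σ, rfl⟩, hf⟩
    exact (h i n).2 ⟨π, hπ, o, σ, ho, hf⟩
  · rintro h i n
    refine ⟨(ℓ.step i).ctxSubst ℓ.hole ℓ.μ n, ?_⟩
    rintro ⟨π, hπ, o, σ, ho, hf⟩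
    exact h i π hπ ⟨n, o, _, ho, ⟨σ, rfl⟩, hf⟩

theorem noViolationCode_inputCode (R : TRS L) (ℓ : Loop R) (Pat : List (ForbiddenPattern L)) :
    NoViolationCode (inputCode e R ℓ Pat) ↔
      ℓ.IsStrategyLoop (PatternStep R {π | π ∈ Pat}) := by
  -- The list of terms has one entry more than the list of positions, so index `i` is in range for
  -- both and the defaults are never used.
  have ht : ∀ i : Fin ℓ.m, (List.ofFn fun i => termCode e (ℓ.t i)).getD i [] =
      termCode e (ℓ.t i.castSucc) := by
    intro i
    have hi : (i : ℕ) < ℓ.m + 1 := i.2.trans (Nat.lt_succ_self _)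
    rw [List.getD_eq_getElem _ _ (by rw [List.length_ofFn]; exact hi), List.getElem_ofFn]
    rfl
  have hq : ∀ i : Fin ℓ.m, (List.ofFn ℓ.q).getD i [] = ℓ.q i := by
    intro i
    rw [List.getD_eq_getElem _ _ (by rw [List.length_ofFn]; exact i.2), List.getElem_ofFn]
  have key : ∀ (i : Fin ℓ.m) (π : ForbiddenPattern L),
      (¬ ∃ n, Violates ℓ.C ℓ.μ ℓ.p (ℓ.q i) (ℓ.t i.castSucc) π n 0) ↔
      ∀ n ∈ List.range (violationBound (frameCode e ℓ.C ℓ.μ ℓ.p)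
          ((List.ofFn fun i => termCode e (ℓ.t i)).getD i []) (patternCode e π) + 1),
        ¬ ViolatesCode (frameCode e ℓ.C ℓ.μ ℓ.p) ((List.ofFn ℓ.q).getD i [])
          ((List.ofFn fun i => termCode e (ℓ.t i)).getD i []) (patternCode e π) n := by
    intro i π
    rw [exists_violates_iff e ℓ.hole (ℓ.step i).exists_func, ht, hq]
    simp only [violatesCode_iff, List.mem_range, Nat.lt_succ_iff, not_exists, not_and]
  rw [Loop.isStrategyLoop_patternStep_iff]
  simp only [key]
  refine Iff.symm ?_
  constructor
  · intro h i hi π' hπ'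
    obtain ⟨π, hπ, rfl⟩ := List.mem_map.1 hπ'
    have hi : i < ℓ.m := by simpa [inputCode, loopCode] using hi
    exact h ⟨i, hi⟩ π hπ
  · intro h i π hπ
    exact h i (by simp [inputCode, loopCode]) (patternCode e π) (List.mem_map_of_mem hπ)

end Correctness

/-! ### Primitive recursiveness of the procedure -/

section Computability

open Primrec

variable {α β γ : Type} [Primcodable α] [Primcodable β] [Primcodable γ]

theorem primrecPred_exists_mem {ι : Type*} {κ : Type*} [Primcodable ι] [Primcodable κ]
    {f : ι → List κ} {r : ι → κ → Prop} (hf : Primrec f) (hr : PrimrecRel r) :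
    PrimrecPred fun a => ∃ b ∈ f a, r a b :=
  hr.swap.exists_mem_list.comp hf Primrec.id

theorem primrecPred_forall_mem {ι : Type*} {κ : Type*} [Primcodable ι] [Primcodable κ]
    {f : ι → List κ} {r : ι → κ → Prop} (hf : Primrec f) (hr : PrimrecRel r) :
    PrimrecPred fun a => ∀ b ∈ f a, r a b :=
  hr.swap.forall_mem_list.comp hf Primrec.id

theorem primrec_symbolArity : Primrec (symbolArity (α := α)) :=
  (Primrec.sumCasesOn Primrec.id (Primrec.const 0).to₂ (fst.comp snd).to₂).of_eq fun s => by
    cases s <;> rfl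

theorem primrec_skipStep : Primrec₂ (skipStep (α := α)) :=
  Primrec.ite (Primrec.eq.comp (fst.comp fst) (Primrec.const 0))
    (Primrec.pair (Primrec.const 0)
      (list_append.comp (snd.comp fst) (list_cons.comp snd (Primrec.const []))))
    (Primrec.pair (nat_add.comp (nat_sub.comp (fst.comp fst) (Primrec.const 1))
      (primrec_symbolArity.comp snd)) (snd.comp fst))

theorem primrec_skipTerms : Primrec₂ (skipTerms (α := α)) :=
  snd.comp (list_foldl snd (Primrec.pair fst (Primrec.const []))
    (primrec_skipStep.comp (fst.comp snd) (snd.comp snd)).to₂)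

theorem primrec_firstTerm : Primrec (firstTerm (α := α)) :=
  list_take.comp (nat_sub.comp list_length
    (list_length.comp (primrec_skipTerms.comp (Primrec.const 1) Primrec.id))) Primrec.id

theorem primrec_childCode : Primrec₂ (childCode (α := α)) :=
  option_bind (list_head?.comp fst) (Primrec.ite
    (nat_lt.comp (snd.comp fst) (primrec_symbolArity.comp snd))
    (option_some.comp (primrec_firstTerm.comp
      (primrec_skipTerms.comp (snd.comp fst) (list_tail.comp (fst.comp fst)))))
    (Primrec.const none)).to₂

theorem primrec_subCode : Primrec₂ (subCode (α := α)) :=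
  list_foldl snd (option_some.comp fst)
    (option_bind (fst.comp snd) (primrec_childCode.comp snd (snd.comp (snd.comp fst))).to₂).to₂

theorem primrec_headCode : Primrec₂ (headCode (α := α)) :=
  option_bind primrec_subCode (list_head?.comp snd).to₂

theorem primrec_substCode {f : γ → α → TermCode β} {c : γ → TermCode α} (hf : Primrec₂ f)
    (hc : Primrec c) : Primrec fun a => substCode (f a) (c a) := by
  have h : Primrec₂ fun (a : γ) (s : α ⊕ ℕ × ℕ) =>
      Sum.casesOn (motive := fun _ => TermCode β) s (f a) fun g => [.inr g] :=
    Primrec.sumCasesOn snd (hf.comp (fst.comp fst) snd).to₂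
      (list_cons.comp (sumInr.comp snd) (Primrec.const [])).to₂
  exact list_flatMap hc (h.of_eq fun _ s => by cases s <;> rfl)

theorem primrec_positionsCode : Primrec (positionsCode (α := α)) :=
  nat_iterate list_length (Primrec.const [[]])
    (list_cons.comp (Primrec.const []) (list_flatMap (list_range.comp (list_length.comp fst))
      (list_map (snd.comp fst) (list_cons.comp (snd.comp fst) snd).to₂).to₂)).to₂

theorem primrecRel_matchesCode : PrimrecRel MatchesCode := by
  have hleft : Primrec fun o : Option (ℕ ⊕ ℕ × ℕ) => o.any Sum.isLeft :=
    (option_casesOn Primrec.id (Primrec.const false) (Primrec.sumCasesOn snd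
      (Primrec.const true).to₂ (Primrec.const false).to₂).to₂).of_eq fun o => by
        rcases o with _ | (_ | _) <;> rfl
  refine primrecPred_forall_mem (primrec_positionsCode.comp fst)
    (primrecPred_forall_mem (primrec_positionsCode.comp (fst.comp fst)) ?_)
  have hl : Primrec fun x : ((TermCode ℕ × TermCode ℕ) × Position) × Position => x.1.1.1 :=
    fst.comp (fst.comp fst)
  have hc : Primrec fun x : ((TermCode ℕ × TermCode ℕ) × Position) × Position => x.1.1.2 :=
    snd.comp (fst.comp fst)
  have hp : Primrec fun x : ((TermCode ℕ × TermCode ℕ) × Position) × Position => x.1.2 :=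
    snd.comp fst
  have hq : Primrec fun x : ((TermCode ℕ × TermCode ℕ) × Position) × Position => x.2 := snd
  have hlp := primrec_headCode.comp hl hp
  exact .and
    (.or (Primrec.eq.comp hlp (Primrec.const none))
      (.or (Primrec.eq.comp (hleft.comp hlp) (Primrec.const true))
        (Primrec.eq.comp (primrec_headCode.comp hc hp) hlp)))
    (.or (Primrec.eq.comp (hleft.comp hlp) (Primrec.const false))
      (.or (PrimrecPred.not (Primrec.eq.comp (primrec_headCode.comp hl hq) hlp))
        (Primrec.eq.comp (primrec_subCode.comp hc hp) (primrec_subCode.comp hc hq))))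

theorem primrec_applyCode : Primrec₂ applyCode :=
  primrec_substCode (option_getD.comp (listLookup.comp snd (fst.comp fst))
    (list_cons.comp (sumInl.comp snd) (Primrec.const []))).to₂ snd

theorem primrec_fillCode : Primrec₂ fillCode := by
  have h : Primrec₂ fun (p : TermCode (Option ℕ) × TermCode ℕ) (x : Option ℕ) =>
      Option.casesOn (motive := fun _ => TermCode ℕ) x p.2 fun y => [.inl y] :=
    option_casesOn snd (snd.comp fst)
      (list_cons.comp (sumInl.comp snd) (Primrec.const [])).to₂
  exact primrec_substCode (h.of_eq fun _ x => by cases x <;> rfl) fst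

theorem primrec_ctxSubstCode {C : γ → TermCode (Option ℕ)} {m : γ → List (ℕ × TermCode ℕ)}
    {c : γ → TermCode ℕ} {n : γ → ℕ} (hC : Primrec C) (hm : Primrec m) (hc : Primrec c)
    (hn : Primrec n) : Primrec fun a => ctxSubstCode (C a) (m a) (c a) (n a) :=
  nat_iterate hn hc
    (primrec_fillCode.comp (hC.comp fst) (primrec_applyCode.comp (hm.comp fst) snd)).to₂

theorem primrecPred_forbidsCode {κ : γ → ℕ} {p o : γ → Position} (hκ : Primrec κ)
    (hp : Primrec p) (ho : Primrec o) : PrimrecPred fun a => ForbidsCode (κ a) (p a) (o a) :=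
  .or (.and (Primrec.eq.comp hκ (Primrec.const 0)) (Primrec.eq.comp hp ho))
    (.or (.and (Primrec.eq.comp hκ (Primrec.const 1))
        (.and (Primrec.eq.comp (list_take.comp (list_length.comp hp) ho) hp)
          (PrimrecPred.not (Primrec.eq.comp hp ho))))
      (.and (Primrec.eq.comp hκ (Primrec.const 2))
        (.and (Primrec.eq.comp (list_take.comp (list_length.comp ho) hp) ho)
          (PrimrecPred.not (Primrec.eq.comp ho hp)))))

theorem primrec_flatten_replicate {n : γ → ℕ} {p : γ → Position} (hn : Primrec n)
    (hp : Primrec p) : Primrec fun a => (List.replicate (n a) (p a)).flatten :=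
  (list_flatMap (list_range.comp hn) (hp.comp fst).to₂).of_eq fun a => by
    simp [List.flatMap]

theorem primrecPred_violatesCode {F : γ → FrameCode} {q : γ → Position} {c : γ → TermCode ℕ}
    {π : γ → PatternCode} {n : γ → ℕ} (hF : Primrec F) (hq : Primrec q) (hc : Primrec c)
    (hπ : Primrec π) (hn : Primrec n) :
    PrimrecPred fun a => ViolatesCode (F a) (q a) (c a) (π a) (n a) := by
  have hT : Primrec fun a => ctxSubstCode (F a).1 (F a).2.1 (c a) (n a) :=
    primrec_ctxSubstCode (fst.comp hF) (fst.comp (snd.comp hF)) hc hn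
  refine primrecPred_exists_mem (primrec_positionsCode.comp hT) ?_
  have hsub : Primrec fun x : γ × Position =>
      subCode (ctxSubstCode (F x.1).1 (F x.1).2.1 (c x.1) (n x.1)) x.2 :=
    primrec_subCode.comp (hT.comp fst) snd
  exact .and (PrimrecPred.not (Primrec.eq.comp hsub (Primrec.const none)))
    (.and (primrecRel_matchesCode.comp ((fst.comp hπ).comp fst)
        (option_getD.comp hsub (Primrec.const [])))
      (primrecPred_forbidsCode ((snd.comp (snd.comp hπ)).comp fst)
        (list_append.comp (primrec_flatten_replicate (hn.comp fst)
          ((snd.comp (snd.comp hF)).comp fst)) (hq.comp fst))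
        (list_append.comp snd ((fst.comp (snd.comp hπ)).comp fst))))

theorem primrec_violationBound {F : γ → FrameCode} {c : γ → TermCode ℕ} {π : γ → PatternCode}
    (hF : Primrec F) (hc : Primrec c) (hπ : Primrec π) :
    Primrec fun a => violationBound (F a) (c a) (π a) := by
  have hm : Primrec fun a => (F a).2.1 := fst.comp (snd.comp hF)
  have hJ : Primrec fun a => (F a).2.2.length + (π a).1.length :=
    nat_add.comp (list_length.comp (snd.comp (snd.comp hF))) (list_length.comp (fst.comp hπ))
  have hK : Primrec fun a => ((π a).1.length + 2) * (F a).2.1.length :=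
    nat_mul.comp (nat_add.comp (list_length.comp (fst.comp hπ)) (Primrec.const 2))
      (list_length.comp hm)
  have hN := list_length.comp (nat_iterate hK (primrec_ctxSubstCode (fst.comp hF) hm hc hJ)
    (primrec_applyCode.comp (hm.comp fst) snd).to₂)
  exact nat_add.comp
    (nat_add.comp (nat_add.comp (nat_add.comp hJ hN) (Primrec.const 1))
      (list_length.comp (fst.comp (snd.comp hπ))))
    (nat_add.comp hK (nat_add.comp (list_length.comp hm) (Primrec.const 1)))

theorem primrecPred_noViolationCode : PrimrecPred NoViolationCode := by
  have hloop : Primrec fun x : InputCode => x.2.1 := fst.comp snd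
  have hqs : Primrec fun x : InputCode => x.2.1.2.1 := fst.comp (snd.comp hloop)
  have hF : Primrec fun x : InputCode => x.2.1.2.2 := snd.comp (snd.comp hloop)
  have ht : Primrec fun x : InputCode × ℕ => x.1.2.1.1.getD x.2 [] :=
    (list_getD []).comp ((fst.comp hloop).comp fst) snd
  have hq : Primrec fun x : InputCode × ℕ => x.1.2.1.2.1.getD x.2 [] :=
    (list_getD []).comp (hqs.comp fst) snd
  refine primrecPred_forall_mem (list_range.comp (list_length.comp hqs))
    (primrecPred_forall_mem ((snd.comp snd).comp fst) (primrecPred_forall_mem (list_range.comp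
      (succ.comp (primrec_violationBound (hF.comp (fst.comp fst)) (ht.comp fst) snd))) ?_))
  exact PrimrecPred.not (primrecPred_violatesCode (hF.comp (fst.comp (fst.comp fst)))
    (hq.comp (fst.comp fst)) (ht.comp (fst.comp fst)) (snd.comp fst) snd)

end Computability

theorem PrimrecPred.computablePred {α : Type*} [Primcodable α] {p : α → Prop} :
    PrimrecPred p → ComputablePred p
  | ⟨i, h⟩ => ⟨i, h.to_comp⟩

end TermRewriting

theorem mainTheorem1 :
    ∃ P : TermRewriting.InputCode → Prop, ComputablePred P ∧
      ∀ (L : FirstOrder.Language) [Finite (Σ n, L.Functions n)]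
        (e : (Σ n, L.Functions n) ↪ ℕ)
        (R : TermRewriting.TRS L) (ℓ : TermRewriting.Loop R)
        (Pat : List (TermRewriting.ForbiddenPattern L)),
        P (TermRewriting.inputCode e R ℓ Pat) ↔
          ℓ.IsStrategyLoop (TermRewriting.PatternStep R {π | π ∈ Pat}) :=
  -- The predicate is chosen before the signature and its numbering; injectivity of the numbering
  -- lets equality of codes decide equality of terms.
  ⟨TermRewriting.NoViolationCode,
    TermRewriting.PrimrecPred.computablePred TermRewriting.primrecPred_noViolationCode,
    fun _ _ e R ℓ Pat => TermRewriting.noViolationCode_inputCode e R ℓ Pat⟩
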